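/- Work over $\mathbb{C}$. Let $r\geq 1$, let $n_1\leq\dots\leq n_r$ and $d_1,\dots,d_r$ be positive integers with $d:=d_1\leq d_i-2$ for every $i\neq 1$, and let $SV\subset\mathbb{P}^N$, $N=\prod_{i=1}^r\binom{n_i+d_i}{d_i}-1$, be the Segre-Veronese variety, i.e. the product $\mathbb{P}^{n_1}\times\dots\times\mathbb{P}^{n_r}$ embedded by the complete linear system $|\mathcal{O}(d_1,\dots,d_r)|$. For $p\in SV$ and $m\geq 0$ let $T^m_pSV\subset\mathbb{P}^N$ be the $m$-osculating space of $SV$ at $p$: the linear span of $p$ and of the partial derivatives of order at most $m$ at $p$ of a local parametrization of $SV$; in particular $T^1_pSV$ is the tangent space. Let $(p_0,\dots,p_{n_1})\in SV^{\,n_1+1}$ be general, and set $T=\langle T^{d}_{p_0}SV,\dots,T^{d}_{p_{n_1}}SV\rangle$. Then a general hyperplane $H\subset\mathbb{P}^N$ containing $T$ is not tangent to $SV$ along a positive dimensional subvariety, that is, there is no irreducible closed subvariety $Z\subseteq SV$ with $\dim Z>0$ and $T^1_xSV\subseteq H$ for all $x\in Z$. Moreover, hyperplanes containing $T$ exist ($T\neq\mathbb{P}^N$)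 as soon as $r\geq 2$. Here "general" means: in a dense Zariski open subset of $SV^{\,n_1+1}$, respectively of the projective space of hyperplanes containing $T$. -/

import Mathlib

open MvPolynomial

namespace SegreVeronese

noncomputable section

/-! ### Zariski topologies and generality -/

/-- The Zariski topology on a complex vector space: the sets where one polynomial in the
linear functionals does not vanish form a basis of open sets. -/
@[reducible] def vecZariski (V : Type*) [AddCommGroup V] [Module ℂ V] : TopologicalSpace V :=
  TopologicalSpace.generateFrom
    {U | ∃ f : MvPolynomial (Module.Dual ℂ V) ℂ, U = {v | eval (fun φ => φ v) f ≠ 0}}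

/-- The Zariski topology on a projective space, as the quotient of `V \ {0}`. -/
@[reducible] def projZariski (V : Type*) [AddCommGroup V] [Module ℂ V] :
    TopologicalSpace (Projectivization ℂ V) :=
  TopologicalSpace.coinduced (fun v : {v : V // v ≠ 0} => Projectivization.mk ℂ v.1 v.2)
    (TopologicalSpace.induced Subtype.val (vecZariski V))

/-- The Zariski topology on a product of projective spaces (not the product topology), as the
quotient of the set of tuples of nonzero vectors. -/
@[reducible] def multiProjZariski {ι : Type*} (V : ι → Type*) [∀ i, AddCommGroup (V i)]
    [∀ i, Module ℂ (V i)] : TopologicalSpace (∀ i, Projectivization ℂ (V i)) :=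
  TopologicalSpace.coinduced
    (fun v : {v : ∀ i, V i // ∀ i, v i ≠ 0} => fun i => Projectivization.mk ℂ (v.1 i) (v.2 i))
    (TopologicalSpace.induced Subtype.val (vecZariski (∀ i, V i)))

/-- A property holds for a general point if it holds on a dense open subset. -/
def ForGeneral {X : Type*} (t : TopologicalSpace X) (P : X → Prop) : Prop :=
  ∃ U : Set X, @IsOpen X t U ∧ @Dense X t U ∧ ∀ x ∈ U, P x

/-- (Irreducible, closed) subvarieties of a projective space. -/
def IsSubvariety {V : Type*} [AddCommGroup V] [Module ℂ V]
    (Z : Set (Projectivization ℂ V)) : Prop :=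
  @IsClosed _ (projZariski V) Z ∧ @IsIrreducible _ (projZariski V) Z

/-- The dimension of a subset of a projective space with its induced Zariski topology. -/
def projDim {V : Type*} [AddCommGroup V] [Module ℂ V]
    (Z : Set (Projectivization ℂ V)) : WithBot ℕ∞ :=
  @topologicalKrullDim Z (TopologicalSpace.induced Subtype.val (projZariski V))

/-! ### The Segre-Veronese variety -/

variable {r : ℕ} (n d : Fin r → ℕ)

/-- The product `ℙ^{n_1} × ⋯ × ℙ^{n_r}`. -/
abbrev MultiProj : Type := ∀ l : Fin r, Projectivization ℂ (Fin (n l + 1) → ℂ)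

/-- The indices of the homogeneous coordinates of `ℙ^N`: an `r`-tuple whose `l`-th entry is a
multiset of `d_l` elements of `{0, …, n_l}`, i.e. a monomial of multidegree `(d_1, …, d_r)`. -/
abbrev Index : Type := ∀ l : Fin r, Sym (Fin (n l + 1)) (d l)

/-- The vector space `ℂ^{N+1}`. -/
abbrev Ambient : Type := Index n d → ℂ

/-- The homogeneous coordinates `X_{l,j}` on the factors. -/
abbrev Var : Type := Σ l : Fin r, Fin (n l + 1)

variable {n d}

/-- The monomial of multidegree `d` with index `J`. -/
def mono (J : Index n d) : MvPolynomial (Var n) ℂ :=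
  ∏ l, ((J l : Multiset (Fin (n l + 1))).map fun j => X (⟨l, j⟩ : Var n)).prod

/-- The value of a polynomial at a tuple of vectors. -/
def evalAt (v : ∀ l, Fin (n l + 1) → ℂ) (f : MvPolynomial (Var n) ℂ) : ℂ :=
  eval (fun s : Var n => v s.1 s.2) f

variable (d) in
/-- All monomials of multidegree `d`, evaluated at a tuple of vectors. -/
def svVec (v : ∀ l, Fin (n l + 1) → ℂ) : Ambient n d := fun J => evalAt v (mono J)

theorem exists_coord_ne_zero {m : ℕ} (x : Projectivization ℂ (Fin m → ℂ)) :
    ∃ j, x.rep j ≠ 0 := Function.ne_iff.1 x.rep_nonzero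

theorem svVec_ne_zero (v : ∀ l, Fin (n l + 1) → ℂ) (hv : ∀ l, v l ≠ 0) : svVec d v ≠ 0 := by
  choose j hj using fun l => Function.ne_iff.1 (hv l)
  refine Function.ne_iff.2 ⟨fun l => Sym.replicate (d l) (j l), ?_⟩
  simp only [svVec, evalAt, mono, Sym.coe_replicate, Multiset.map_replicate,
    Multiset.prod_replicate, map_prod, map_pow, eval_X, Pi.zero_apply]
  exact Finset.prod_ne_zero_iff.2 fun l _ => pow_ne_zero _ (hj l)

variable (d) in
/-- The embedding of the product by the complete linear system `|𝒪(d_1, …, d_r)|`. -/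
def svMap (x : MultiProj n) : Projectivization ℂ (Ambient n d) :=
  Projectivization.mk ℂ (svVec d fun l => (x l).rep) (svVec_ne_zero _ fun l => (x l).rep_nonzero)

variable (n d) in
/-- The Segre-Veronese variety. -/
def variety : Set (Projectivization ℂ (Ambient n d)) := Set.range (svMap d)

/-! ### Osculating spaces -/

variable (d) in
/-- The vector of iterated partial derivatives of all monomials of multidegree `d` with respect
to the variables in the list `L`, evaluated at a tuple of vectors. -/
def derivVec (v : ∀ l, Fin (n l + 1) → ℂ) (L : List (Var n)) : Ambient n d :=
  fun J => evalAt v (L.foldr (fun s f => pderiv s f) (mono J))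

/-- Indices of a standard affine chart of the product that contains the point `x`. -/
def chart (x : MultiProj n) (l : Fin r) : Fin (n l + 1) := (exists_coord_ne_zero (x l)).choose

variable (d) in
/-- (The linear subspace of `ℂ^{N+1}` over) the `m`-osculating space of the Segre-Veronese
variety at the point `svMap d x`. Let `v` be a representative of `x` with `v_{l, c_l} ≠ 0`.
Then `t ↦ svVec d (v + t)`, for the tuples `t` with all `t_{l, c_l} = 0`, is a local
parametrization at `t = 0`; the coordinate of index `({c_1, …, c_1}, …, {c_r, …, c_r})` is
constant and nonzero, so that it takes values in an affine chart `ℂ^N` of `ℙ^N`.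
The space is spanned by its partial derivatives at `t = 0` of order at most `m`, the one of
order zero being the point itself. -/
def osculatingSpace (x : MultiProj n) (m : ℕ) : Submodule ℂ (Ambient n d) :=
  Submodule.span ℂ {w | ∃ L : List (Var n), L.length ≤ m ∧
    (∀ l, (⟨l, chart x l⟩ : Var n) ∉ L) ∧ w = derivVec d (fun l => (x l).rep) L}

open scoped Classical in
/-- The Euler derivation `∑_j X_{l,j} ∂_{l,j}`. -/
def euler (l : Fin r) : Derivation ℂ (MvPolynomial (Var n) ℂ) (MvPolynomial (Var n) ℂ) :=
  mkDerivation ℂ fun s => if s.1 = l then X s else 0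

theorem derivation_sum_apply {A : Type*} [CommSemiring A] [Algebra ℂ A] {ι : Type*}
    (s : Finset ι) (D : ι → Derivation ℂ A A) (f : A) : (∑ i ∈ s, D i) f = ∑ i ∈ s, D i f := by
  rw [← Derivation.coeFnAddMonoidHom_apply, map_sum, Finset.sum_apply]
  rfl

theorem euler_eq_sum (l : Fin r) (f : MvPolynomial (Var n) ℂ) :
    euler l f = ∑ j, X (⟨l, j⟩ : Var n) * pderiv (⟨l, j⟩ : Var n) f := by
  have h : (euler l : Derivation ℂ (MvPolynomial (Var n) ℂ) (MvPolynomial (Var n) ℂ)) =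
      ∑ j, (X (⟨l, j⟩ : Var n) : MvPolynomial (Var n) ℂ) • pderiv (⟨l, j⟩ : Var n) := by
    refine derivation_ext fun s => ?_
    obtain ⟨k, i⟩ := s
    rw [derivation_sum_apply]
    by_cases hk : k = l
    · subst hk
      simp [euler, mkDerivation_X, pderiv_X, Pi.single_apply]
    · have : ∀ j, (⟨l, j⟩ : Var n) ≠ ⟨k, i⟩ := fun j e => hk (congrArg Sigma.fst e).symm
      simp [euler, mkDerivation_X, pderiv_X, hk, (this _).symm]
  rw [h, derivation_sum_apply]
  simp

theorem euler_prod (l k : Fin r) (M : Multiset (Fin (n k + 1))) :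
    euler l (M.map fun j => X (⟨k, j⟩ : Var n)).prod =
      (if k = l then (M.card : ℂ) else 0) • (M.map fun j => X (⟨k, j⟩ : Var n)).prod := by
  classical
  induction M using Multiset.induction_on with
  | empty => simp
  | cons a M ih =>
    rw [Multiset.map_cons, Multiset.prod_cons, Derivation.leibniz, ih]
    by_cases h : k = l
    · simp [euler, mkDerivation_X, h, add_smul, mul_comm]
    · simp [euler, mkDerivation_X, h]

theorem euler_mono (l : Fin r) (J : Index n d) : euler l (mono J) = (d l : ℂ) • mono J := by
  classical
  have key : ∀ s : Finset (Fin r),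
      euler l (∏ k ∈ s, ((J k : Multiset (Fin (n k + 1))).map
        fun j => X (⟨k, j⟩ : Var n)).prod) =
      (if l ∈ s then (d l : ℂ) else 0) • ∏ k ∈ s, ((J k : Multiset (Fin (n k + 1))).map
        fun j => X (⟨k, j⟩ : Var n)).prod := by
    intro s
    induction s using Finset.induction_on with
    | empty => simp
    | insert a s ha ih =>
      rw [Finset.prod_insert ha, Derivation.leibniz, ih, euler_prod]
      by_cases h : a = l
      · subst h
        simp [ha, mul_comm]
      · simp [h, Ne.symm h]
  simpa [mono] using key Finset.univ

theorem euler_pderiv (l : Fin r) (s : Var n) (f : MvPolynomial (Var n) ℂ) :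
    euler l (pderiv s f) =
      pderiv s (euler l f) - (if s.1 = l then (1 : ℂ) else 0) • pderiv s f := by
  classical
  have h : ⁅(euler l : Derivation ℂ (MvPolynomial (Var n) ℂ) (MvPolynomial (Var n) ℂ)),
      (pderiv s : Derivation ℂ (MvPolynomial (Var n) ℂ) (MvPolynomial (Var n) ℂ))⁆ = -((if s.1 = l then (1 : ℂ) else 0) • pderiv s) := by
    refine derivation_ext fun t => ?_
    rw [Derivation.commutator_apply]
    by_cases e : t = s
    · subst e
      by_cases h : t.1 = l <;> simp [euler, mkDerivation_X, h]
    · by_cases h : t.1 = l <;> by_cases h' : s.1 = l <;>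
        simp [euler, mkDerivation_X, h, h', pderiv_X, e]
  have := DFunLike.congr_fun h f
  simp only [Derivation.commutator_apply, Derivation.neg_apply, Derivation.smul_apply] at this
  rw [sub_eq_iff_eq_add] at this
  rw [this]; abel

theorem exists_euler_foldr (l : Fin r) (L : List (Var n)) :
    ∃ a : ℂ, ∀ J : Index n d, euler l (L.foldr (fun s f => pderiv s f) (mono J)) =
      a • L.foldr (fun s f => pderiv s f) (mono J) := by
  induction L with
  | nil => exact ⟨d l, fun J => euler_mono l J⟩
  | cons s L ih =>
    obtain ⟨a, ha⟩ := ih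
    refine ⟨a - (if s.1 = l then 1 else 0), fun J => ?_⟩
    rw [List.foldr_cons, euler_pderiv, ha, Derivation.map_smul, sub_smul]

theorem pderiv_swap (s t : Var n) (f : MvPolynomial (Var n) ℂ) :
    pderiv s (pderiv t f) = pderiv t (pderiv s f) := by
  classical
  have h : ⁅(pderiv s : Derivation ℂ (MvPolynomial (Var n) ℂ) (MvPolynomial (Var n) ℂ)),
      (pderiv t : Derivation ℂ (MvPolynomial (Var n) ℂ) (MvPolynomial (Var n) ℂ))⁆ = 0 := by
    refine derivation_ext fun u => ?_
    rw [Derivation.commutator_apply]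
    by_cases e : u = s <;> by_cases e' : u = t <;>
      simp [pderiv_X, Pi.single_apply, e, e'] <;> split_ifs <;> simp
  have := DFunLike.congr_fun h f
  simpa [Derivation.commutator_apply, sub_eq_zero] using this

theorem derivVec_perm (v : ∀ l, Fin (n l + 1) → ℂ) {L L' : List (Var n)} (h : L.Perm L') :
    derivVec d v L = derivVec d v L' := by
  have : LeftCommutative (fun (s : Var n) (f : MvPolynomial (Var n) ℂ) => pderiv s f) :=
    ⟨pderiv_swap⟩
  funext J
  simp only [derivVec]
  rw [h.foldr_eq]

/-- By Euler's relations, the derivatives with respect to the variables `X_{l, c_l}` add nothing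
to the span, so that the osculating space does not depend on the affine chart. -/
theorem osculatingSpace_eq (x : MultiProj n) (m : ℕ) :
    osculatingSpace d x m = Submodule.span ℂ {w | ∃ L : List (Var n), L.length ≤ m ∧
      w = derivVec d (fun l => (x l).rep) L} := by
  classical
  refine le_antisymm (Submodule.span_mono fun w ⟨L, hL, _, hw⟩ => ⟨L, hL, hw⟩)
    (Submodule.span_le.2 ?_)
  rintro w ⟨L, hL, rfl⟩
  set v : ∀ l, Fin (n l + 1) → ℂ := fun l => (x l).rep with hv
  let p : Var n → Bool := fun s => decide (s.2 = chart x s.1)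
  suffices H : ∀ k, ∀ L : List (Var n), L.length ≤ m → L.countP p = k →
      derivVec d v L ∈ osculatingSpace d x m from H _ L hL rfl
  intro k
  induction k with
  | zero =>
    intro L hL hk
    rw [List.countP_eq_zero] at hk
    exact Submodule.subset_span ⟨L, hL, fun l hl => by simpa [p] using hk _ hl, rfl⟩
  | succ k ih =>
    intro L hL hk
    obtain ⟨⟨l, c⟩, hs, hps⟩ := List.countP_pos_iff.1 (show 0 < L.countP p by omega)
    obtain rfl : c = chart x l := by simpa [p] using hps
    have hperm := List.perm_cons_erase hs
    set L' := L.erase ⟨l, chart x l⟩ with hL'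
    have hlen : L'.length + 1 ≤ m := by
      rw [← List.length_cons (a := (⟨l, chart x l⟩ : Var n)), ← hperm.length_eq]; exact hL
    have hcnt : L'.countP p = k := by
      have := hperm.countP_eq p
      rw [List.countP_cons_of_pos hps] at this
      omega
    rw [derivVec_perm v hperm]
    have hne : v l (chart x l) ≠ 0 := (exists_coord_ne_zero (x l)).choose_spec
    obtain ⟨a, ha⟩ := exists_euler_foldr (d := d) l L'
    have hsum : ∑ j, v l j • derivVec d v (⟨l, j⟩ :: L') = a • derivVec d v L' := by
      funext J
      have := congrArg (evalAt v) (ha J)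
      rw [euler_eq_sum] at this
      simpa [evalAt, derivVec, Finset.sum_apply, smul_eval] using this
    rw [← Finset.add_sum_erase _ _ (Finset.mem_univ (chart x l)), ← eq_sub_iff_add_eq] at hsum
    rw [← (osculatingSpace d x m).smul_mem_iff hne, hsum]
    refine Submodule.sub_mem _ (Submodule.smul_mem _ _ (ih L' (by omega) hcnt))
      (Submodule.sum_mem _ fun j hj => Submodule.smul_mem _ _ (ih _ hlen ?_))
    rw [List.countP_cons_of_neg (by simpa [p] using Finset.ne_of_mem_erase hj), hcnt]

/-- The locus of points of the Segre-Veronese variety at which (the projectivization of) `H` is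
tangent to it, i.e. contains the tangent space, which is the osculating space of order `1`. -/
def contactLocus (H : Submodule ℂ (Ambient n d)) : Set (Projectivization ℂ (Ambient n d)) :=
  {P | ∃ x : MultiProj n, P = svMap d x ∧ osculatingSpace d x 1 ≤ H}

/-- The hyperplane of a nonzero linear form that vanishes on `T`, so that
`ℙ(T.dualAnnihilator)` is the projective space of hyperplanes containing `T`. -/
def hyperplane {T : Submodule ℂ (Ambient n d)}
    (ℓ : Projectivization ℂ T.dualAnnihilator) : Submodule ℂ (Ambient n d) :=
  LinearMap.ker (ℓ.rep : Module.Dual ℂ (Ambient n d))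

end

end SegreVeronese

/-! A hyperplane containing `T` is a form of multidegree `d` vanishing to order `d 0 + 1` at the
points p_k, and its contact locus is the set of singular points of that form. It suffices to find
one such form F whose singular points are under control, and to spread finiteness of the contact
locus to an open set of forms; finite sets have dimension at most 0.

In each factor the `n 0 + 1` vectors of general points are independent, so a linear change of
coordinates gives p_k = (e_k, …, e_k). The order condition is then a condition on monomials. Let F
combine the admissible ones (`Adm`) with coefficients c algebraically independent over ℚ. If F is
singular at w, apply to F(w) = 0 a derivation δ of ℂ with δ(c_j) = 1 that kills the other
coefficients: the terms with δ(w_s) carry a factor ∂_s F(w) = 0, so the j-th monomial vanishes at w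
(`eval_monomial_eq_zero_of_singular`). Since `d l ≥ d 0 + 2` for l ≠ 0, there are enough monomials
to force all components of w but the first to be proportional to e_k, for one k
(`exists_support_of_base`). There the derivatives of F in X_{l₁,j}, j ≠ k, are combinations of the
powers w_{0,u}^{d 0}, u ≠ k, with a generic square matrix; hence w lies over p_k
(`exists_support_of_singular`).

For openness (`exists_open_finite_contactLocus`), take a form H nonzero at every p_k. The partials
of F and H have no common zero in the product, so they generate all monomials of some large
multidegree. Such identities survive small changes of F, up to an invertible matrix, and show that
on the contact locus the coordinates divided by H are eigenvalues of fixed matrices.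

If r = 1, only the zero form vanishes to that order, and there is no hyperplane to consider; if r ≥
2, F is nonzero, so `T ≠ ⊤`. -/

namespace SegreVeronese

/-! ### Derivations of ℂ and a Bertini theorem for monomial systems -/

noncomputable section

/-- Dual derivations of an algebraically independent family of complex numbers. -/
theorem exists_derivation_of_isTranscendenceBasis {s : Type*} {x : s → ℂ}
    (hx : IsTranscendenceBasis ℚ x) (D : s → ℂ) :
    ∃ δ : Derivation ℚ ℂ ℂ, ∀ i, δ (x i) = D i := by
  let _ : Algebra (MvPolynomial s ℚ) ℂ := (aeval x : MvPolynomial s ℚ →ₐ[ℚ] ℂ).toRingHom.toAlgebra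
  have : IsScalarTower ℚ (MvPolynomial s ℚ) ℂ := IsScalarTower.of_algebraMap_eq' (Subsingleton.elim _ _)
  have hX : ∀ i, algebraMap (MvPolynomial s ℚ) ℂ (X i) = x i := fun i => aeval_X x i
  have : FaithfulSMul (MvPolynomial s ℚ) ℂ :=
    (faithfulSMul_iff_algebraMap_injective _ _).2 hx.1
  let K := FractionRing (MvPolynomial s ℚ)
  let _ : Algebra K ℂ := FractionRing.liftAlgebra _ _
  have : IsScalarTower (MvPolynomial s ℚ) K ℂ := FractionRing.isScalarTower_liftAlgebra _ _
  have : Algebra.IsAlgebraic (MvPolynomial s ℚ) ℂ := by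
    have := hx.isAlgebraic
    refine Algebra.IsAlgebraic.ringHom_of_comp_eq (R := Algebra.adjoin ℚ (Set.range x)) (A := ℂ)
      hx.1.aevalEquiv.symm (RingHom.id ℂ) hx.1.aevalEquiv.symm.injective Function.surjective_id ?_
    ext a
    obtain ⟨p, rfl⟩ := hx.1.aevalEquiv.surjective a
    simp [RingHom.algebraMap_toAlgebra]
  have : Algebra.IsAlgebraic K ℂ := 
    Algebra.IsAlgebraic.extendScalars (R := MvPolynomial s ℚ) (IsFractionRing.injective _ K)
  -- Localizations and separable algebraic extensions are formally étale, so a derivation of the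
  -- polynomial ring extends to ℂ through Kähler differentials.
  have : Algebra.FormallyEtale (MvPolynomial s ℚ) K :=
    Algebra.FormallyEtale.of_isLocalization (nonZeroDivisors _)
  have : Algebra.FormallyEtale K ℂ := Algebra.FormallyEtale.of_isSeparable K ℂ
  have : Algebra.FormallyEtale (MvPolynomial s ℚ) ℂ := Algebra.FormallyEtale.comp _ K _
  let δ₀ : Derivation ℚ (MvPolynomial s ℚ) ℂ := mkDerivation ℚ D
  let φ := (δ₀.liftKaehlerDifferential.liftBaseChange ℂ).comp
    (KaehlerDifferential.tensorKaehlerEquivOfFormallyEtale ℚ (MvPolynomial s ℚ) ℂ).symm.toLinearMap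
  refine ⟨φ.compDer (KaehlerDifferential.D ℚ ℂ), fun i => ?_⟩
  rw [← hX]
  simp [φ, δ₀, KaehlerDifferential.tensorKaehlerEquivOfFormallyEtale_symm_D_algebraMap]

/-- By cardinality a transcendence basis of ℂ over ℚ is infinite, so it has room for `ι`; a
derivation may be prescribed freely on it. -/
theorem exists_algebraicIndependent_derivation (ι : Type*) [Finite ι] :
    ∃ c : ι → ℂ, AlgebraicIndependent ℚ c ∧
      ∀ j, ∃ δ : Derivation ℚ ℂ ℂ, δ (c j) = 1 ∧ ∀ i, i ≠ j → δ (c i) = 0 := by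
  classical
  obtain ⟨s, hs⟩ := exists_isTranscendenceBasis ℚ ℂ
  have hinf : Infinite s := by
    by_contra h
    rw [not_infinite_iff_finite] at h
    have h' := IsAlgClosed.cardinal_le_max_transcendence_basis' _ hs
    simp only [Cardinal.mk_complex, Cardinal.mkRat] at h'
    have h3 : Cardinal.mk s < Cardinal.aleph0 := Cardinal.lt_aleph0_of_finite s
    rw [max_eq_left h3.le, max_self] at h'
    exact absurd h' (not_le.2 Cardinal.aleph0_lt_continuum)
  let f : ι ↪ s := (Finite.equivFin ι).toEmbedding.trans
    (Fin.valEmbedding.trans (Infinite.natEmbedding s))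
  refine ⟨fun i => f i, hs.1.comp f f.injective, fun j => ?_⟩
  obtain ⟨δ, hδ⟩ := exists_derivation_of_isTranscendenceBasis hs (Pi.single (f j) 1)
  refine ⟨δ, by simp [hδ], fun i hi => ?_⟩
  rw [hδ, Pi.single_eq_of_ne (fun h => hi (f.injective h))]

/-- The chain rule for a derivation of the coefficient field. -/
theorem derivation_eval_prod_X {σ : Type*} [Fintype σ] (δ : Derivation ℚ ℂ ℂ) (w : σ → ℂ)
    (m : σ →₀ ℕ) :
    δ (eval w (monomial m 1)) = ∑ s, eval w (pderiv s (monomial m (1 : ℂ))) * δ (w s) := by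
  classical
  induction m using Finsupp.induction_linear with
  | zero => simp
  | add f g hf hg =>
    have : (monomial (f + g) (1 : ℂ)) = monomial f 1 * monomial g 1 := by simp
    simp only [this, map_mul, Derivation.leibniz, hf, hg, smul_eq_mul, map_add, add_mul,
      Finset.sum_add_distrib, Finset.mul_sum]
    congr 1 <;> exact Finset.sum_congr rfl fun _ _ => by ring
  | single i k =>
    rw [Finset.sum_eq_single i (fun j _ hj => by simp [pderiv_monomial, hj]) (by simp)]
    rw [pderiv_monomial, ← Finsupp.single_tsub, eval_monomial, eval_monomial,
      Finsupp.prod_single_index (by simp), Finsupp.prod_single_index (by simp), one_mul, one_mul,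
      Derivation.leibniz_pow, Finsupp.single_eq_same, nsmul_eq_mul, smul_eq_mul, mul_assoc]

/-- Bertini's theorem for linear systems spanned by monomials: singular points of the generic
member are base points. -/
theorem eval_monomial_eq_zero_of_singular {σ ι : Type*} [Fintype σ] [Fintype ι] (m : ι → σ →₀ ℕ)
    {c : ι → ℂ} (hc : ∀ j, ∃ δ : Derivation ℚ ℂ ℂ, δ (c j) = 1 ∧ ∀ i, i ≠ j → δ (c i) = 0)
    {w : σ → ℂ} (hw : eval w (∑ i, c i • monomial (m i) (1 : ℂ)) = 0)
    (hw' : ∀ s, eval w (pderiv s (∑ i, c i • monomial (m i) (1 : ℂ))) = 0) (j : ι) :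
    eval w (monomial (m j) 1) = 0 := by
  classical
  -- The coordinates of `w` need not be constants for `δ`, but each `δ (w s)` comes multiplied by a
  -- partial derivative that vanishes at `w`.
  obtain ⟨δ, h1, h0⟩ := hc j
  have h := congrArg δ hw
  simp only [map_sum, smul_eval, Derivation.leibniz, derivation_eval_prod_X, map_zero,
    Finset.sum_add_distrib, smul_eq_mul, Finset.mul_sum] at h
  rw [Finset.sum_comm, Finset.sum_eq_zero, zero_add,
    Finset.sum_eq_single j (fun i _ hi => by rw [h0 i hi, mul_zero]) (by simp), h1, mul_one] at h
  · exact h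
  · intro s _
    have := hw' s
    simp only [map_sum, Derivation.map_smul, smul_eval] at this
    simp only [← mul_assoc, ← Finset.sum_mul]
    rw [this, zero_mul]

end

/-! ### Admissible monomials and their base locus -/

noncomputable section

variable {r : ℕ} {n d : Fin r → ℕ}

/-- The exponent vector of the monomial with index `J`. -/
def exps (J : Index n d) : Var n →₀ ℕ :=
  Finsupp.equivFunOnFinite.symm fun s => (J s.1 : Multiset (Fin (n s.1 + 1))).count s.2

@[simp]
theorem exps_apply (J : Index n d) (s : Var n) :
    exps J s = (J s.1 : Multiset (Fin (n s.1 + 1))).count s.2 := rfl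

theorem mono_eq_monomial (J : Index n d) : mono J = monomial (exps J) 1 := by
  classical
  rw [monomial_eq, C_1, one_mul, Finsupp.prod_fintype _ _ (by simp), Fintype.prod_sigma, mono]
  refine Finset.prod_congr rfl fun l _ => ?_
  rw [Finset.prod_multiset_map_count]
  refine Finset.prod_subset (Finset.subset_univ _) fun j _ hj => ?_
  rw [Multiset.mem_toFinset] at hj
  rw [Multiset.count_eq_zero_of_notMem hj, pow_zero]

theorem exps_injective : Function.Injective (exps : Index n d → Var n →₀ ℕ) := by
  intro J J' h
  funext l
  refine Subtype.ext (Multiset.ext.2 fun j => ?_)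
  exact DFunLike.congr_fun h (⟨l, j⟩ : Var n)

theorem exists_sym_coe {α : Type*} {k : ℕ} (M : Multiset α) (h : M.card = k) :
    ∃ S : Sym α k, (S : Multiset α) = M := ⟨⟨M, h⟩, rfl⟩

theorem exists_exps (m : Var n →₀ ℕ) (hm : ∀ l, ∑ j, m ⟨l, j⟩ = d l) :
    ∃ J : Index n d, exps J = m := by
  classical
  choose J hJ using fun l => exists_sym_coe (k := d l) (∑ j, m ⟨l, j⟩ • {j}) (by simp [hm])
  refine ⟨J, ?_⟩
  ext ⟨l, j⟩
  simp [hJ, Multiset.count_sum', Multiset.count_singleton]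

theorem sum_exps (J : Index n d) (l : Fin r) : ∑ j, exps J ⟨l, j⟩ = d l := by
  classical
  have h := Multiset.sum_count_eq_card (s := Finset.univ)
    (m := (J l : Multiset (Fin (n l + 1)))) (by simp)
  rw [Sym.card_coe] at h
  exact h

theorem eval_mono (w : Var n → ℂ) (J : Index n d) :
    eval w (mono J) = ∏ s, w s ^ exps J s := by
  rw [mono_eq_monomial, eval_monomial, one_mul, Finsupp.prod_fintype _ _ (by simp)]

theorem eval_mono_ne_zero {w : Var n → ℂ} {J : Index n d}
    (h : ∀ l, ∀ j ∈ (J l : Multiset (Fin (n l + 1))), w ⟨l, j⟩ ≠ 0) : eval w (mono J) ≠ 0 := by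
  rw [eval_mono, Finset.prod_ne_zero_iff]
  rintro ⟨l, j⟩ -
  by_cases hj : j ∈ (J l : Multiset (Fin (n l + 1)))
  · exact pow_ne_zero _ (h l j hj)
  · rw [exps_apply, Multiset.count_eq_zero_of_notMem hj, pow_zero]
    exact one_ne_zero

variable [NeZero r]

/-- The `k`-th coordinate of the first factor, as a coordinate of the `l`-th one. -/
abbrev emb (h : ∀ l, n 0 ≤ n l) (l : Fin r) : Fin (n 0 + 1) → Fin (n l + 1) :=
  Fin.castLE (Nat.succ_le_succ (h l))

theorem emb_injective (h : ∀ l, n 0 ≤ n l) (l : Fin r) : Function.Injective (emb h l) :=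
  Fin.castLE_injective _

/-- Monomials that vanish to order `d 0 + 1` at the coordinate points and are pure powers in the
first group of variables. -/
def Adm (h : ∀ l, n 0 ≤ n l) (J : Index n d) : Prop :=
  (∃ u, J 0 = Sym.replicate (d 0) u) ∧
    ∀ k, d 0 + 1 ≤ ∑ l, (d l - (J l : Multiset (Fin (n l + 1))).count (emb h l k))

/-- At a coordinate point k ≠ u the pure power in the first factor already supplies order `d 0`, so
one more variable suffices; otherwise a single factor supplies the whole order. -/
theorem adm_of_le {h : ∀ l, n 0 ≤ n l} {J : Index n d} {u : Fin (n 0 + 1)}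
    (hu : J 0 = Sym.replicate (d 0) u)
    (hJ : ∀ k, (∃ l, d 0 + 1 ≤ d l - (J l : Multiset (Fin (n l + 1))).count (emb h l k)) ∨
      (k ≠ u ∧ ∃ l, l ≠ 0 ∧ 1 ≤ d l - (J l : Multiset (Fin (n l + 1))).count (emb h l k))) :
    Adm h J := by
  refine ⟨⟨u, hu⟩, fun k => ?_⟩
  set f := fun l => d l - (J l : Multiset (Fin (n l + 1))).count (emb h l k)
  rcases hJ k with ⟨l, hl⟩ | ⟨hk, l, hl0, hl⟩
  · exact hl.trans (Finset.single_le_sum (f := f) (fun _ _ => Nat.zero_le _) (Finset.mem_univ l))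
  · have h0 : f 0 = d 0 := by
      simp only [f, hu, Sym.coe_replicate, Multiset.count_replicate]
      rw [if_neg, Nat.sub_zero]
      simpa [emb] using hk.symm
    have hl' : 1 ≤ f l := hl
    calc d 0 + 1 ≤ f 0 + f l := by omega
      _ = ∑ i ∈ ({0, l} : Finset (Fin r)), f i := (Finset.sum_pair hl0.symm).symm
      _ ≤ ∑ i, f i := Finset.sum_le_sum_of_subset (Finset.subset_univ _)

/-- The base locus of the admissible monomials. -/
theorem exists_support_of_base (h : ∀ l, n 0 ≤ n l) (hd : ∀ l, 1 ≤ d l)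
    (hgap : ∀ l, l ≠ 0 → d 0 + 2 ≤ d l)
    {w : Var n → ℂ} (hw : ∀ l, ∃ j, w ⟨l, j⟩ ≠ 0)
    (hbase : ∀ J : Index n d, Adm h J → eval w (mono J) = 0) :
    ∃ k, ∀ l, l ≠ 0 → ∀ j, j ≠ emb h l k → w ⟨l, j⟩ = 0 := by
  classical
  choose s hs using hw
  obtain ⟨k, hk⟩ : ∃ k, ∀ l, l ≠ 0 → s l = emb h l k := by
    by_contra! hcon
    -- If no k serves all l ≠ 0, the product of the X_{l,s l}^{d l} is admissible: for each k some
    -- factor l ≠ 0 misses k and supplies order `d l`.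
    refine eval_mono_ne_zero (w := w) (J := fun l => Sym.replicate (d l) (s l)) ?_ (hbase _ ?_)
    · intro l j hj
      rw [Sym.coe_replicate] at hj
      rw [Multiset.eq_of_mem_replicate hj]
      exact hs l
    · refine adm_of_le rfl fun k => Or.inl ?_
      obtain ⟨l, hl, hne⟩ := hcon k
      refine ⟨l, ?_⟩
      rw [Sym.coe_replicate, Multiset.count_replicate, if_neg hne]
      have := hgap l hl
      omega
  -- The test monomial contains X_{0,s 0}^{d 0} and X_{l,a} X_{l,b}^{d l - 1}. At the point of index
  -- b its order is at least `d 0` plus 1; elsewhere it is at least `d l - 1`, and the gap of 2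
  -- makes this enough.
  have two : ∀ l, l ≠ 0 → ∀ a b, a ≠ b → emb h l (s 0) ≠ b → w ⟨l, a⟩ ≠ 0 → w ⟨l, b⟩ ≠ 0 →
      False := by
    intro l hl a b hab hb hwa hwb
    have hcard : (a ::ₘ Multiset.replicate (d l - 1) b).card = d l := by
      have := hd l
      simp
      omega
    obtain ⟨S, hS⟩ := exists_sym_coe _ hcard
    refine eval_mono_ne_zero (w := w) (J := Function.update
      (fun l => Sym.replicate (d l) (s l)) l S) ?_ (hbase _ ?_)
    · intro m j hj
      by_cases hm : m = l
      · subst hm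
        rw [Function.update_self, hS] at hj
        rcases Multiset.mem_cons.1 hj with rfl | hj
        · exact hwa
        · rwa [Multiset.eq_of_mem_replicate hj]
      · rw [Function.update_of_ne hm, Sym.coe_replicate] at hj
        rw [Multiset.eq_of_mem_replicate hj]
        exact hs m
    · refine adm_of_le (u := s 0) (by rw [Function.update_of_ne hl.symm]) fun k' => ?_
      have hg := hgap l hl
      by_cases hk' : emb h l k' = b
      · refine Or.inr ⟨fun e => hb (e ▸ hk'), l, hl, ?_⟩
        rw [Function.update_self, hS]
        simp only [Multiset.count_cons, Multiset.count_replicate, hk', hab.symm,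
          if_true, if_false]
        omega
      · refine Or.inl ⟨l, ?_⟩
        rw [Function.update_self, hS]
        simp only [Multiset.count_cons, Multiset.count_replicate, Ne.symm hk',
          if_false]
        split_ifs <;> omega
  refine ⟨k, fun l hl j hj => ?_⟩
  by_contra hwj
  have hsk : w ⟨l, emb h l k⟩ ≠ 0 := hk l hl ▸ hs l
  -- Of two distinct nonzero coordinates at most one has the index `s 0`; the other takes the role
  -- of b.
  by_cases e : emb h l (s 0) = j
  · exact two l hl j (emb h l k) hj (e ▸ hj) hwj hsk
  · exact two l hl (emb h l k) j hj.symm e hsk hwj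

end

/-! ### Singular points of the generic admissible form -/

noncomputable section

/-- The generic determinant is a nonzero polynomial over ℚ, so independent entries cannot annihilate
it. -/
theorem det_ne_zero_of_algebraicIndependent {m : Type*} [Fintype m] [DecidableEq m]
    (M : Matrix m m ℂ) (hM : AlgebraicIndependent ℚ fun p : m × m => M p.1 p.2) : M.det ≠ 0 := by
  have h : M.det = aeval (fun p : m × m => M p.1 p.2) (Matrix.mvPolynomialX m m ℚ).det := by
    rw [AlgHom.map_det]
    congr 1
    ext i j
    simp
  rw [h]
  intro h0
  exact Matrix.det_mvPolynomialX_ne_zero m ℚ (hM (h0.trans (map_zero _).symm))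

variable {r : ℕ} {n d : Fin r → ℕ}

theorem eval_pderiv_mono (w : Var n → ℂ) (s : Var n) (J : Index n d) :
    eval w (pderiv s (mono J)) = exps J s * ∏ t, w t ^ (exps J - Finsupp.single s 1 : Var n →₀ ℕ) t := by
  rw [mono_eq_monomial, pderiv_monomial, eval_monomial, one_mul, Finsupp.prod_fintype _ _ (by simp)]

variable [NeZero r]

/-- These monomials are linear in a direction transverse to the base locus: their order at the k-th
point is `d 0` from the first factor plus 1 from X_{l₁,j}. -/
theorem exists_adm_mixed (h : ∀ l, n 0 ≤ n l) (hgap : ∀ l, l ≠ 0 → d 0 + 2 ≤ d l)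
    {l₁ : Fin r} (hl₁ : l₁ ≠ 0) {k u j : Fin (n 0 + 1)} (hu : u ≠ k) (hj : j ≠ k) :
    ∃ J : Index n d, Adm h J ∧ J 0 = Sym.replicate (d 0) u ∧
      (J l₁ : Multiset (Fin (n l₁ + 1))) =
        emb h l₁ j ::ₘ Multiset.replicate (d l₁ - 1) (emb h l₁ k) ∧
      ∀ l, l ≠ 0 → l ≠ l₁ → J l = Sym.replicate (d l) (emb h l k) := by
  classical
  have hg := hgap l₁ hl₁
  obtain ⟨S, hS⟩ := exists_sym_coe (k := d l₁)
    (emb h l₁ j ::ₘ Multiset.replicate (d l₁ - 1) (emb h l₁ k)) (by simp; omega)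
  let J : Index n d := Function.update (Function.update
    (fun l => Sym.replicate (d l) (emb h l k)) 0 (Sym.replicate (d 0) u)) l₁ S
  have h0 : J 0 = Sym.replicate (d 0) u := by
    simp only [J]
    rw [Function.update_of_ne hl₁.symm, Function.update_self]
  have h1 : (J l₁ : Multiset (Fin (n l₁ + 1))) =
      emb h l₁ j ::ₘ Multiset.replicate (d l₁ - 1) (emb h l₁ k) := by
    simp only [J]
    rw [Function.update_self, hS]
  refine ⟨J, adm_of_le h0 fun k' => ?_, h0, h1, fun l hl hl' => ?_⟩
  · by_cases hk : k' = k
    · refine Or.inr ⟨hk ▸ hu.symm, l₁, hl₁, ?_⟩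
      have : emb h l₁ k ≠ emb h l₁ j := fun e => hj (emb_injective h l₁ e).symm
      rw [h1, hk, Multiset.count_cons_of_ne this, Multiset.count_replicate_self]
      omega
    · refine Or.inl ⟨l₁, ?_⟩
      have : emb h l₁ k ≠ emb h l₁ k' := fun e => hk (emb_injective h l₁ e).symm
      rw [h1, Multiset.count_cons, Multiset.count_replicate, if_neg this]
      split_ifs <;> omega
  · simp only [J]
    rw [Function.update_of_ne hl', Function.update_of_ne hl]

theorem eval_pderiv_mixed (h : ∀ l, n 0 ≤ n l) {l₁ : Fin r} (hl₁ : l₁ ≠ 0)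
    {k u j : Fin (n 0 + 1)} (hj : j ≠ k) {J : Index n d} (h0 : J 0 = Sym.replicate (d 0) u)
    (h1 : (J l₁ : Multiset (Fin (n l₁ + 1))) =
        emb h l₁ j ::ₘ Multiset.replicate (d l₁ - 1) (emb h l₁ k))
    (h2 : ∀ l, l ≠ 0 → l ≠ l₁ → J l = Sym.replicate (d l) (emb h l k)) (w : Var n → ℂ) :
    eval w (pderiv ⟨l₁, emb h l₁ j⟩ (mono J)) = w ⟨0, u⟩ ^ d 0 *
      ∏ l ∈ Finset.univ.erase 0, w ⟨l, emb h l k⟩ ^ (if l = l₁ then d l - 1 else d l) := by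
  classical
  have hne : emb h l₁ k ≠ emb h l₁ j := fun e => hj (emb_injective h l₁ e).symm
  have hc : exps J ⟨l₁, emb h l₁ j⟩ = 1 := by
    rw [exps_apply, h1, Multiset.count_cons_self, Multiset.count_replicate, if_neg hne]
  rw [eval_pderiv_mono, hc, Nat.cast_one, one_mul, Fintype.prod_sigma,
    ← Finset.mul_prod_erase _ _ (Finset.mem_univ (0 : Fin r))]
  congr 1
  · have h3 : ∀ i : Fin (n 0 + 1), (exps J - Finsupp.single ⟨l₁, emb h l₁ j⟩ 1 : Var n →₀ ℕ) ⟨0, i⟩ =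
        if u = i then d 0 else 0 := by
      intro i
      have : (⟨l₁, emb h l₁ j⟩ : Var n) ≠ ⟨0, i⟩ := fun e => hl₁ (congrArg Sigma.fst e)
      rw [Finsupp.tsub_apply, exps_apply, h0, Sym.coe_replicate, Multiset.count_replicate,
        Finsupp.single_eq_of_ne this.symm, Nat.sub_zero]
    rw [Finset.prod_eq_single u (fun i _ hi => by rw [h3, if_neg hi.symm, pow_zero]) (by simp),
      h3, if_pos rfl]
  · refine Finset.prod_congr rfl fun l hl => ?_
    have hl0 := Finset.ne_of_mem_erase hl
    have h3 : ∀ i, (exps J - Finsupp.single ⟨l₁, emb h l₁ j⟩ 1 : Var n →₀ ℕ) ⟨l, i⟩ =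
        if emb h l k = i then (if l = l₁ then d l - 1 else d l) else 0 := by
      intro i
      rw [Finsupp.tsub_apply, exps_apply]
      by_cases e : l = l₁
      · subst e
        rw [h1, Multiset.count_cons, Multiset.count_replicate, Finsupp.single_apply]
        by_cases e2 : i = emb h l j
        · subst e2
          simp
        · have : (⟨l, emb h l j⟩ : Var n) ≠ ⟨l, i⟩ := by
            simpa using Ne.symm e2
          rw [if_neg e2, if_neg this]
          simp
      · have : (⟨l₁, emb h l₁ j⟩ : Var n) ≠ ⟨l, i⟩ := fun h => e (congrArg Sigma.fst h).symm
        rw [h2 l hl0 e, Sym.coe_replicate, Multiset.count_replicate,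
          Finsupp.single_eq_of_ne this.symm, Nat.sub_zero, if_neg e]
    rw [Finset.prod_eq_single (emb h l k) (fun i _ hi => by rw [h3, if_neg hi.symm, pow_zero])
      (by simp), h3, if_pos rfl]

/-- Outside the first factor, a derivative that survives on the base locus leaves only variables of
index k. If u were k too, the order at the k-th point would be at most 1, less than `d 0 + 1`. -/
theorem mixed_of_eval_pderiv_ne_zero (h : ∀ l, n 0 ≤ n l) (hd : ∀ l, 1 ≤ d l) {l₁ : Fin r}
    (hl₁ : l₁ ≠ 0) {k j : Fin (n 0 + 1)} {w : Var n → ℂ}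
    (hw : ∀ l, l ≠ 0 → ∀ j, j ≠ emb h l k → w ⟨l, j⟩ = 0) {J : Index n d} (hJ : Adm h J)
    (hne : eval w (pderiv ⟨l₁, emb h l₁ j⟩ (mono J)) ≠ 0) :
    ∃ u, u ≠ k ∧ J 0 = Sym.replicate (d 0) u ∧
      (J l₁ : Multiset (Fin (n l₁ + 1))) =
        emb h l₁ j ::ₘ Multiset.replicate (d l₁ - 1) (emb h l₁ k) ∧
      ∀ l, l ≠ 0 → l ≠ l₁ → J l = Sym.replicate (d l) (emb h l k) := by
  classical
  obtain ⟨⟨u, hu⟩, hJk⟩ := hJ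
  rw [eval_pderiv_mono, mul_ne_zero_iff, Finset.prod_ne_zero_iff] at hne
  obtain ⟨hne1, hne2⟩ := hne
  have hz : ∀ l, l ≠ 0 → ∀ i, i ≠ emb h l k →
      (exps J - Finsupp.single ⟨l₁, emb h l₁ j⟩ 1 : Var n →₀ ℕ) ⟨l, i⟩ = 0 := by
    intro l hl i hi
    by_contra hcon
    exact hne2 ⟨l, i⟩ (Finset.mem_univ _) (by rw [hw l hl i hi, zero_pow hcon])
  have hmem : emb h l₁ j ∈ (J l₁ : Multiset (Fin (n l₁ + 1))) := by
    rw [← Multiset.count_ne_zero]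
    exact_mod_cast hne1
  have h1 : (J l₁ : Multiset (Fin (n l₁ + 1))) =
        emb h l₁ j ::ₘ Multiset.replicate (d l₁ - 1) (emb h l₁ k) := by
    rw [← Multiset.cons_erase hmem]
    congr 1
    refine Multiset.eq_replicate.2 ⟨?_, fun i hi => ?_⟩
    · rw [Multiset.card_erase_of_mem hmem, Sym.card_coe, Nat.pred_eq_sub_one]
    · by_contra hik
      have h3 := hz l₁ hl₁ i hik
      rw [← Multiset.count_pos] at hi
      rw [Finsupp.tsub_apply, exps_apply, Finsupp.single_apply] at h3
      by_cases e : i = emb h l₁ j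
      · subst e
        rw [Multiset.count_erase_self] at hi
        simp at h3
        omega
      · rw [Multiset.count_erase_of_ne e] at hi
        have : (⟨l₁, emb h l₁ j⟩ : Var n) ≠ ⟨l₁, i⟩ := by simpa using Ne.symm e
        rw [if_neg this] at h3
        simp only [] at h3
        omega
  have h2 : ∀ l, l ≠ 0 → l ≠ l₁ → J l = Sym.replicate (d l) (emb h l k) := by
    intro l hl hl'
    refine Sym.coe_injective ?_
    rw [Sym.coe_replicate]
    refine Multiset.eq_replicate.2 ⟨Sym.card_coe, fun i hi => ?_⟩
    by_contra hik
    have h3 := hz l hl i hik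
    have : (⟨l₁, emb h l₁ j⟩ : Var n) ≠ ⟨l, i⟩ := fun e => hl' (congrArg Sigma.fst e).symm
    rw [Finsupp.tsub_apply, exps_apply, Finsupp.single_eq_of_ne this.symm, Nat.sub_zero] at h3
    exact Multiset.count_ne_zero.2 hi h3
  refine ⟨u, ?_, hu, h1, h2⟩
  rintro rfl
  have h3 := hJk u
  rw [Finset.sum_eq_single l₁, h1] at h3
  · have hd0 := hd 0
    have : d l₁ - 1 ≤ Multiset.count (emb h l₁ u)
        (emb h l₁ j ::ₘ Multiset.replicate (d l₁ - 1) (emb h l₁ u)) := by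
      rw [Multiset.count_cons, Multiset.count_replicate_self]
      omega
    omega
  · intro l _ hl
    by_cases hl0 : l = 0
    · subst hl0
      rw [hu, Sym.coe_replicate, Multiset.count_replicate, if_pos (by simp [emb]), Nat.sub_self]
    · rw [h2 l hl0 hl, Sym.coe_replicate, Multiset.count_replicate_self, Nat.sub_self]
  · simp

/-- The generic combination of the admissible monomials is singular at most at the coordinate
points. -/
theorem exists_support_of_singular (h : ∀ l, n 0 ≤ n l) (hd : ∀ l, 1 ≤ d l)
    (hgap : ∀ l, l ≠ 0 → d 0 + 2 ≤ d l) {l₁ : Fin r} (hl₁ : l₁ ≠ 0)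
    [Fintype {J : Index n d // Adm h J}] {c : {J : Index n d // Adm h J} → ℂ} (hc : AlgebraicIndependent ℚ c)
    (hδ : ∀ j, ∃ δ : Derivation ℚ ℂ ℂ, δ (c j) = 1 ∧ ∀ i, i ≠ j → δ (c i) = 0)
    {w : Var n → ℂ} (hw : ∀ l, ∃ j, w ⟨l, j⟩ ≠ 0)
    (hsing : eval w (∑ J, c J • mono J.1) = 0)
    (hsing' : ∀ s, eval w (pderiv s (∑ J, c J • mono J.1)) = 0) :
    ∃ k, ∀ l j, j ≠ emb h l k → w ⟨l, j⟩ = 0 := by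
  classical
  obtain ⟨k, hk⟩ := exists_support_of_base h hd hgap hw fun J hJ => by
    simp only [mono_eq_monomial] at hsing hsing'
    rw [mono_eq_monomial]
    exact eval_monomial_eq_zero_of_singular (fun J : {J : Index n d // Adm h J} => exps J.1) hδ
      hsing hsing' ⟨J, hJ⟩
  refine ⟨k, fun l => ?_⟩
  by_cases hl : l = 0
  swap
  · exact hk l hl
  subst hl
  choose JJ hJJ h0 h1 h2 using fun p : {u // u ≠ k} × {j // j ≠ k} =>
    exists_adm_mixed h hgap hl₁ p.1.2 p.2.2
  -- Both indices run over the coordinates of the first factor other than k, so the matrix is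
  -- square; its entries are distinct coefficients.
  let M : Matrix {j // j ≠ k} {u // u ≠ k} ℂ := fun j u => c ⟨JJ (u, j), hJJ _⟩
  have hM : M.det ≠ 0 := by
    refine det_ne_zero_of_algebraicIndependent M
      (hc.comp (fun p : {j // j ≠ k} × {u // u ≠ k} => ⟨JJ (p.2, p.1), hJJ _⟩) ?_)
    rintro ⟨j, u⟩ ⟨j', u'⟩ e
    have e' : JJ (u, j) = JJ (u', j') := congrArg Subtype.val e
    have e1 := h1 (u, j)
    rw [e', h1, Multiset.cons_inj_left] at e1
    have e0 := h0 (u, j)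
    rw [e', h0] at e0
    have e2 : (u' : Fin (n 0 + 1)) ∈ (Sym.replicate (d 0) u.1 : Sym (Fin (n 0 + 1)) (d 0)) := by
      rw [← e0, Sym.mem_replicate]
      have := hd 0
      exact ⟨by omega, rfl⟩
    rw [Sym.mem_replicate] at e2
    exact Prod.ext (Subtype.ext (emb_injective h l₁ e1).symm) (Subtype.ext e2.2.symm)
  set C := ∏ l ∈ Finset.univ.erase (0 : Fin r),
    w ⟨l, emb h l k⟩ ^ (if l = l₁ then d l - 1 else d l) with hC
  have hC0 : C ≠ 0 := by
    refine Finset.prod_ne_zero_iff.2 fun l hl => pow_ne_zero _ fun h0 => ?_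
    obtain ⟨j, hj⟩ := hw l
    by_cases e : j = emb h l k
    · exact hj (e ▸ h0)
    · exact hj (hk l (Finset.ne_of_mem_erase hl) j e)
  -- The derivative in X_{l₁,j} at `w` is `C` times the j-th entry of this product.
  have hy : M.mulVec (fun u => w ⟨0, u.1⟩ ^ d 0) = 0 := by
    funext j
    have h3 := hsing' ⟨l₁, emb h l₁ j.1⟩
    simp only [map_sum, Derivation.map_smul, smul_eval] at h3
    rw [← Finset.sum_of_injOn (s := Finset.univ)
      (f := fun u : {u // u ≠ k} => M j u * (w ⟨0, u.1⟩ ^ d 0 * C))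
      (fun u : {u // u ≠ k} => (⟨JJ (u, j), hJJ _⟩ : {J : Index n d // Adm h J})) ?_
      (by simp) ?_ ?_] at h3
    · simp only [← mul_assoc, ← Finset.sum_mul] at h3
      exact (mul_eq_zero.1 h3).resolve_right hC0
    · intro u _ u' _ e
      have e' : JJ (u, j) = JJ (u', j) := congrArg Subtype.val e
      have e0 := h0 (u, j)
      rw [e', h0] at e0
      have e2 : (u' : Fin (n 0 + 1)) ∈ (Sym.replicate (d 0) u.1 : Sym (Fin (n 0 + 1)) (d 0)) := by
        rw [← e0, Sym.mem_replicate]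
        have := hd 0
        exact ⟨by omega, rfl⟩
      rw [Sym.mem_replicate] at e2
      exact Subtype.ext e2.2.symm
    · intro J _ hJ
      by_contra hne
      obtain ⟨u, hu, g0, g1, g2⟩ := mixed_of_eval_pderiv_ne_zero h hd hl₁ hk J.2
        (right_ne_zero_of_mul hne)
      refine hJ ⟨⟨u, hu⟩, Finset.mem_coe.2 (Finset.mem_univ _), Subtype.ext (funext fun l => ?_)⟩
      by_cases hl0 : l = 0
      · subst hl0
        exact (h0 (⟨u, hu⟩, j)).trans g0.symm
      · by_cases hl1 : l = l₁
        · subst hl1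
          exact Sym.coe_injective (by rw [g1, h1])
        · exact (h2 (⟨u, hu⟩, j) l hl0 hl1).trans (g2 l hl0 hl1).symm
    · intro u _
      rw [eval_pderiv_mixed h hl₁ j.2 (h0 (u, j)) (h1 (u, j)) (h2 (u, j))]
  intro u hu
  have := congrFun (Matrix.eq_zero_of_mulVec_eq_zero hM hy) ⟨u, by simpa [emb] using hu⟩
  exact eq_zero_of_pow_eq_zero this

end

/-! ### Multigraded forms and the multihomogeneous Nullstellensatz -/

noncomputable section

variable {r : ℕ} {n d e : Fin r → ℕ}

/-- The multidegrees of the homogeneous coordinates. -/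
def wt (s : Var n) : Fin r → ℕ := Pi.single s.1 1

theorem weight_wt (m : Var n →₀ ℕ) (l : Fin r) :
    Finsupp.weight (wt (n := n)) m l = ∑ j, m ⟨l, j⟩ := by
  classical
  rw [Finsupp.weight_apply, Finsupp.sum_fintype _ _ (by simp), Finset.sum_apply,
    Fintype.sum_sigma, Finset.sum_eq_single l]
  · simp [wt]
  · intro k _ hk
    simp [wt, hk.symm]
  · simp

theorem isWeightedHomogeneous_mono (J : Index n d) : IsWeightedHomogeneous wt (mono J) d := by
  rw [mono_eq_monomial]
  exact isWeightedHomogeneous_monomial _ _ _ (funext fun l => by rw [weight_wt, sum_exps])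

theorem weightedHomogeneousComponent_eq_sum (p : MvPolynomial (Var n) ℂ) (e : Fin r → ℕ) :
    weightedHomogeneousComponent wt e p =
      ∑ J : Index n e, coeff (exps J) p • mono J := by
  classical
  ext m
  rw [coeff_weightedHomogeneousComponent, coeff_sum]
  simp only [mono_eq_monomial, coeff_smul, coeff_monomial, smul_eq_mul, mul_ite, mul_one, mul_zero]
  split_ifs with hm
  · obtain ⟨J, rfl⟩ := exists_exps m fun l => by rw [← weight_wt, hm]
    rw [Finset.sum_eq_single J (fun J' _ h => if_neg fun h' => h (exps_injective h')) (by simp),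
      if_pos rfl]
  · refine (Finset.sum_eq_zero fun J _ => if_neg ?_).symm
    rintro rfl
    exact hm (funext fun l => by rw [weight_wt, sum_exps])

theorem IsWeightedHomogeneous.eq_sum_mono {p : MvPolynomial (Var n) ℂ}
    (hp : IsWeightedHomogeneous wt p e) : p = ∑ J : Index n e, coeff (exps J) p • mono J := by
  rw [← weightedHomogeneousComponent_eq_sum, weightedHomogeneousComponent_eq_self hp]

theorem coeff_exps_mono (J J' : Index n e) :
    coeff (exps J') (mono J) = (1 : Matrix (Index n e) (Index n e) ℂ) J J' := by
  classical
  rw [mono_eq_monomial, coeff_monomial, Matrix.one_apply]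
  exact if_congr exps_injective.eq_iff rfl rfl

attribute [local instance] MvPolynomial.weightedGradedAlgebra

theorem weightedHomogeneousComponent_mul_right {a b : MvPolynomial (Var n) ℂ}
    (hb : IsWeightedHomogeneous wt b d) :
    weightedHomogeneousComponent wt (d + e) (a * b) =
      weightedHomogeneousComponent wt e a * b := by
  have := DirectSum.coe_decompose_mul_add_of_right_mem
    (weightedHomogeneousSubmodule ℂ (wt (n := n))) (i := e) (a := a) hb
  rw [add_comm]
  simp only [← weightedDecomposition.decompose'_apply]
  exact this

/-- The multihomogeneous form on the product of projective spaces given by a linear form on the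
ambient space. -/
def form : Module.Dual ℂ (Ambient n d) →ₗ[ℂ] MvPolynomial (Var n) ℂ where
  toFun ℓ := ∑ J, ℓ (Pi.single J 1) • mono J
  map_add' ℓ ℓ' := by simp [add_smul, Finset.sum_add_distrib]
  map_smul' a ℓ := by simp [mul_smul, Finset.smul_sum]

theorem form_apply (ℓ : Module.Dual ℂ (Ambient n d)) :
    form ℓ = ∑ J, ℓ (Pi.single J 1) • mono J := rfl

theorem exists_form_eq {p : MvPolynomial (Var n) ℂ} (hp : IsWeightedHomogeneous wt p d) :
    ∃ ℓ : Module.Dual ℂ (Ambient n d), form ℓ = p := by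
  refine ⟨∑ J, coeff (exps J) p • LinearMap.proj J, ?_⟩
  conv_rhs => rw [IsWeightedHomogeneous.eq_sum_mono hp]
  rw [form_apply]
  refine Finset.sum_congr rfl fun J _ => ?_
  simp [LinearMap.sum_apply, Pi.single_apply]

theorem isWeightedHomogeneous_form (ℓ : Module.Dual ℂ (Ambient n d)) :
    IsWeightedHomogeneous wt (form ℓ) d := by
  rw [form_apply]
  refine IsWeightedHomogeneous.sum _ _ _ fun J _ => ?_
  rw [smul_eq_C_mul]
  exact (isWeightedHomogeneous_mono J).C_mul _

theorem foldr_pderiv_sum_smul {ι : Type*} (t : Finset ι) (a : ι → ℂ)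
    (f : ι → MvPolynomial (Var n) ℂ) (L : List (Var n)) :
    L.foldr (fun s f => pderiv s f) (∑ i ∈ t, a i • f i) =
      ∑ i ∈ t, a i • L.foldr (fun s f => pderiv s f) (f i) := by
  induction L with
  | nil => rfl
  | cons s L ih => simp only [List.foldr_cons, ih, map_sum, Derivation.map_smul]

theorem dual_derivVec (ℓ : Module.Dual ℂ (Ambient n d)) (v : ∀ l, Fin (n l + 1) → ℂ)
    (L : List (Var n)) :
    ℓ (derivVec d v L) = evalAt v (L.foldr (fun s f => pderiv s f) (form ℓ)) := by
  classical
  rw [LinearMap.pi_apply_eq_sum_univ ℓ, form_apply, foldr_pderiv_sum_smul]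
  simp only [evalAt, map_sum, smul_eval, derivVec, smul_eq_mul]
  refine Finset.sum_congr rfl fun J _ => ?_
  rw [mul_comm]
  congr 2
  funext i
  simp [Pi.single_apply, eq_comm]

theorem osculatingSpace_le_ker_iff (ℓ : Module.Dual ℂ (Ambient n d)) (x : MultiProj n) (m : ℕ) :
    osculatingSpace d x m ≤ LinearMap.ker ℓ ↔ ∀ L : List (Var n), L.length ≤ m →
      evalAt (fun l => (x l).rep) (L.foldr (fun s f => pderiv s f) (form ℓ)) = 0 := by
  rw [osculatingSpace_eq, Submodule.span_le]
  constructor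
  · intro h L hL
    rw [← dual_derivVec]
    exact h ⟨L, hL, rfl⟩
  · rintro h _ ⟨L, hL, rfl⟩
    exact (dual_derivVec _ _ _).trans (h L hL)

/-- The partials are multihomogeneous, so their ideal contains the components of its elements. This
allows cofactors that are not homogeneous. -/
theorem eval_component_eq_zero (hd : ∀ l, 1 ≤ d l) (ℓ : Module.Dual ℂ (Ambient n d))
    {w : Var n → ℂ} (hw : ∀ s, eval w (pderiv s (form ℓ)) = 0) {p : MvPolynomial (Var n) ℂ}
    (hp : p ∈ Ideal.span (Set.range fun s => pderiv s (form ℓ))) (e : Fin r → ℕ) :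
    eval w (weightedHomogeneousComponent wt e p) = 0 := by
  classical
  have hom : (Ideal.span (Set.range fun s => pderiv s (form ℓ))).IsHomogeneous
      (weightedHomogeneousSubmodule ℂ (wt (n := n))) := by
    refine Ideal.homogeneous_span _ _ ?_
    rintro _ ⟨s, rfl⟩
    refine ⟨d - wt s, (isWeightedHomogeneous_form ℓ).pderiv ?_⟩
    refine tsub_add_cancel_of_le fun l => ?_
    by_cases h : l = s.1
    · subst h
      simpa [wt] using hd _
    · simp [wt, h]
  have h1 := weightedHomogeneousComponent_mem_of_mem ℂ wt hom hp e
  have h2 : Ideal.span (Set.range fun s => pderiv s (form ℓ)) ≤ RingHom.ker (eval w) := by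
    rw [Ideal.span_le]
    rintro _ ⟨s, rfl⟩
    exact hw s
  exact h2 h1

/-- A multihomogeneous Nullstellensatz. -/
theorem exists_mono_mem (I : Ideal (MvPolynomial (Var n) ℂ))
    (hI : ∀ w : Var n → ℂ, (∀ p ∈ I, eval w p = 0) → ∃ l, ∀ j, w ⟨l, j⟩ = 0) :
    ∃ e : Fin r → ℕ, ∀ e', e ≤ e' → ∀ J : Index n e', mono J ∈ I := by
  classical
  -- On the zero locus of `I` some factor is the zero vector, which kills any product with one
  -- variable from each group.
  have h1 : ∀ σ : ∀ l, Fin (n l + 1), ∃ N, (∏ l, X (⟨l, σ l⟩ : Var n)) ^ N ∈ I := by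
    intro σ
    rw [← Ideal.mem_radical_iff, ← vanishingIdeal_zeroLocus_eq_radical (K := ℂ)]
    intro w hw
    obtain ⟨l, hl⟩ := hI w fun p hp => hw p hp
    rw [map_prod]
    exact Finset.prod_eq_zero (Finset.mem_univ l) (by rw [aeval_X, hl])
  choose N hN using h1
  set M := Finset.univ.sup N
  -- Pigeonhole: in this degree some variable of each group occurs at least `M` times.
  refine ⟨fun l => (n l + 1) * M, fun e' he J => ?_⟩
  have h2 : ∀ l, ∃ j, M ≤ (J l : Multiset (Fin (n l + 1))).count j := by
    intro l
    by_contra! hcon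
    have h3 := sum_exps J l
    have h4 : ∑ j, exps J ⟨l, j⟩ < ∑ _j : Fin (n l + 1), M :=
      Finset.sum_lt_sum_of_nonempty Finset.univ_nonempty fun j _ => hcon j
    rw [h3, Finset.sum_const, Finset.card_univ, Fintype.card_fin, smul_eq_mul] at h4
    exact absurd (he l) (not_le.2 h4)
  choose σ hσ using h2
  refine I.mem_of_dvd ?_ (hN σ)
  rw [← Finset.prod_pow, mono]
  refine Finset.prod_dvd_prod_of_dvd _ _ fun l _ => ?_
  have h3 : Multiset.replicate (N σ) (σ l) ≤ (J l : Multiset (Fin (n l + 1))) :=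
    Multiset.le_count_iff_replicate_le.1
      ((Finset.le_sup (f := N) (Finset.mem_univ σ)).trans (hσ l))
  have h4 := Multiset.prod_dvd_prod_of_le
    (Multiset.map_le_map (f := fun j => (X (⟨l, j⟩ : Var n) : MvPolynomial (Var n) ℂ)) h3)
  simpa using h4

end

/-! ### Finiteness of the contact locus is an open condition -/

noncomputable section

theorem finite_setOf_mulVec_eq_smul {m : Type*} [Fintype m] [DecidableEq m] (A : Matrix m m ℂ) :
    {a : ℂ | ∃ v : m → ℂ, v ≠ 0 ∧ A.mulVec v = a • v}.Finite := by
  refine (Module.End.finite_hasEigenvalue (Matrix.toLin' A)).subset ?_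
  rintro a ⟨v, hv, h⟩
  exact Module.End.hasEigenvalue_of_hasEigenvector
    ⟨Module.End.mem_eigenspace_iff.2 (by rw [Matrix.toLin'_apply, h]), hv⟩

variable {r : ℕ} {n d e : Fin r → ℕ}

theorem exists_eval_mono_ne_zero {w : Var n → ℂ} (hw : ∀ l, ∃ j, w ⟨l, j⟩ ≠ 0) (e : Fin r → ℕ) :
    ∃ J : Index n e, eval w (mono J) ≠ 0 := by
  choose s hs using hw
  refine ⟨fun l => Sym.replicate (e l) (s l), eval_mono_ne_zero fun l j hj => ?_⟩
  rw [Sym.coe_replicate] at hj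
  rw [Multiset.eq_of_mem_replicate hj]
  exact hs l

theorem mono_append (K : Index n d) (J : Index n e) :
    mono (fun l => (K l).append (J l) : Index n (d + e)) = mono K * mono J := by
  simp only [mono, Sym.coe_append, Multiset.map_add, Multiset.prod_add, Finset.prod_mul_distrib]

theorem evalAt_eq_eval (x : MultiProj n) (p : MvPolynomial (Var n) ℂ) :
    evalAt (fun l => (x l).rep) p = eval (fun s : Var n => (x s.1).rep s.2) p := rfl

/-- If `h` divides all monomials of multidegree `d + e`, with quotients of multidegree `e`, along
the contact locus, then the contact locus is finite. -/
theorem finite_contactLocus_of_forall_eval (ℓ : Module.Dual ℂ (Ambient n d))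
    (h : MvPolynomial (Var n) ℂ) (β : Index n (d + e) → Index n e → ℂ)
    (hβ : ∀ w : Var n → ℂ, (∀ s, eval w (pderiv s (form ℓ)) = 0) → ∀ J,
      eval w (mono J) = eval w h * ∑ J', β J J' * eval w (mono J')) :
    (contactLocus (LinearMap.ker ℓ)).Finite := by
  classical
  -- At a contact point the vector of monomials of multidegree `e` is an eigenvector of `A K`, with
  -- eigenvalue the K-th coordinate divided by `h`.
  let A : Index n d → Matrix (Index n e) (Index n e) ℂ := fun K J J' =>
    β (fun l => (K l).append (J l)) J'
  have hfin : (Set.univ.pi fun K : Index n d => {a : ℂ | ∃ v : Index n e → ℂ, v ≠ 0 ∧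
      (A K).mulVec v = a • v}).Finite :=
    Set.Finite.pi fun K => finite_setOf_mulVec_eq_smul (A K)
  let g : Projectivization ℂ (Ambient n d) → Ambient n d → Prop := fun P y =>
    ∃ hy : y ≠ 0, P = Projectivization.mk ℂ y hy
  refine (hfin.biUnion (t := fun y => {P | g P y}) fun y _ => Set.Subsingleton.finite ?_).subset ?_
  · rintro P ⟨hy, rfl⟩ Q ⟨hy', rfl⟩
    rfl
  rintro P ⟨x, rfl, hx⟩
  rw [osculatingSpace_le_ker_iff] at hx
  set w : Var n → ℂ := fun s => (x s.1).rep s.2 with hw_def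
  have hw : ∀ s, eval w (pderiv s (form ℓ)) = 0 := fun s => hx [s] le_rfl
  have hw0 : ∀ l, ∃ j, w ⟨l, j⟩ ≠ 0 := fun l => exists_coord_ne_zero (x l)
  have hh : eval w h ≠ 0 := by
    intro h0
    obtain ⟨J, hJ⟩ := exists_eval_mono_ne_zero hw0 (d + e)
    exact hJ (by rw [hβ w hw, h0, zero_mul])
  have hsv : svVec d (fun l => (x l).rep) = fun K => eval w (mono K) := rfl
  have hsv0 := svVec_ne_zero (d := d) (fun l => (x l).rep) fun l => (x l).rep_nonzero
  have hy0 : (eval w h)⁻¹ • svVec d (fun l => (x l).rep) ≠ 0 :=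
    smul_ne_zero (inv_ne_zero hh) hsv0
  refine Set.mem_biUnion (x := (eval w h)⁻¹ • svVec d fun l => (x l).rep) ?_ ⟨hy0, ?_⟩
  · intro K _
    obtain ⟨J, hJ⟩ := exists_eval_mono_ne_zero hw0 e
    refine ⟨fun J => eval w (mono J), fun h0 => hJ (congrFun h0 J), ?_⟩
    funext J
    have := hβ w hw (fun l => (K l).append (J l))
    rw [mono_append, map_mul] at this
    simp only [Matrix.mulVec, dotProduct, A, Pi.smul_apply, smul_eq_mul, hsv]
    rw [mul_assoc, this, inv_mul_cancel_left₀ hh]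
  · rw [svMap, Projectivization.mk_eq_mk_iff']
    exact ⟨eval w h, by rw [smul_inv_smul₀ hh]⟩

/-- Finiteness of the contact locus is an open condition, when tested by means of a section `h`
that does not meet the contact locus. -/
theorem exists_open_finite_contactLocus (hd : ∀ l, 1 ≤ d l)
    (W : Submodule ℂ (Module.Dual ℂ (Ambient n d))) (ℓ₀ : W) {h : MvPolynomial (Var n) ℂ}
    (hh : IsWeightedHomogeneous wt h d)
    (hne : ∀ w : Var n → ℂ, (∀ l, ∃ j, w ⟨l, j⟩ ≠ 0) →
      (∀ s, eval w (pderiv s (form ℓ₀.1)) = 0) → eval w h ≠ 0) :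
    ∃ D : MvPolynomial (Module.Dual ℂ W) ℂ, eval (fun φ => φ ℓ₀) D ≠ 0 ∧
      ∀ ℓ : W, eval (fun φ => φ ℓ) D ≠ 0 → (contactLocus (LinearMap.ker ℓ.1)).Finite := by
  classical
  obtain ⟨e, he⟩ := exists_mono_mem
    (Ideal.span (Set.range fun s => pderiv s (form ℓ₀.1)) ⊔ Ideal.span {h}) (by
      intro w hw
      by_contra! hcon
      refine hne w hcon (fun s => hw _ ?_) (hw _ ?_)
      · exact Ideal.mem_sup_left (Ideal.subset_span ⟨s, rfl⟩)
      · exact Ideal.mem_sup_right (Ideal.subset_span rfl))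
  have h1 : ∀ J : Index n (d + e), ∃ (a : Var n → MvPolynomial (Var n) ℂ)
      (b : MvPolynomial (Var n) ℂ), ∑ s, a s * pderiv s (form ℓ₀.1) + b * h = mono J := by
    intro J
    obtain ⟨p, hp, q, hq, hpq⟩ := Submodule.mem_sup.1 (he (d + e) (le_add_of_nonneg_left
      (fun _ => Nat.zero_le _)) J)
    obtain ⟨a, rfl⟩ := Ideal.mem_span_range_iff_exists_fun.1 hp
    obtain ⟨b, rfl⟩ := Ideal.mem_span_singleton'.1 hq
    exact ⟨a, b, hpq⟩
  choose a b hab using h1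
  let Φ : Index n (d + e) → Index n (d + e) → Module.Dual ℂ W := fun J J' =>
    lcoeff ℂ (exps J') ∘ₗ (∑ s, LinearMap.mulLeft ℂ (a J s) ∘ₗ (pderiv s).toLinearMap) ∘ₗ
      form ∘ₗ W.subtype
  have hΦ : ∀ J J' (ℓ : W), Φ J J' ℓ =
      coeff (exps J') (∑ s, a J s * pderiv s (form ℓ.1)) := by
    intro J J' ℓ
    simp [Φ, coeff_sum]
  -- The cofactors `a`, `b` found for `ℓ₀` stay frozen while the form varies: the entries are affine
  -- in `ℓ`, and the matrix is 1 at `ℓ₀`.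
  let M : W → Matrix (Index n (d + e)) (Index n (d + e)) ℂ := fun ℓ J J' =>
    coeff (exps J') (∑ s, a J s * pderiv s (form ℓ.1) + b J * h)
  let D : MvPolynomial (Module.Dual ℂ W) ℂ :=
    (Matrix.of fun J J' => X (Φ J J') + C (coeff (exps J') (b J * h)) : Matrix _ _ _).det
  have hD : ∀ ℓ : W, eval (fun φ => φ ℓ) D = (M ℓ).det := by
    intro ℓ
    simp only [D]
    rw [RingHom.map_det]
    congr 1
    ext J J'
    simp [M, hΦ]
  refine ⟨D, ?_, fun ℓ hℓ => ?_⟩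
  · rw [hD]
    have : M ℓ₀ = 1 := by
      ext J J'
      simp only [M]
      rw [hab, coeff_exps_mono]
    rw [this, Matrix.det_one]
    exact one_ne_zero
  · rw [hD] at hℓ
    -- `M` records only the component of multidegree `d + e`. At a singular point the part from the
    -- partials drops out, leaving a multiple of `h`.
    have key : ∀ w : Var n → ℂ, (∀ s, eval w (pderiv s (form ℓ.1)) = 0) → ∀ J,
        (M ℓ).mulVec (fun J' => eval w (mono J')) J =
          eval w (weightedHomogeneousComponent wt e (b J)) * eval w h := by
      intro w hw J
      have h2 : ∑ s, a J s * pderiv s (form ℓ.1) ∈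
          Ideal.span (Set.range fun s => pderiv s (form ℓ.1)) :=
        Ideal.sum_mem _ fun s _ => Ideal.mul_mem_left _ _ (Ideal.subset_span ⟨s, rfl⟩)
      have h3 := congrArg (eval w) (weightedHomogeneousComponent_eq_sum
        (∑ s, a J s * pderiv s (form ℓ.1) + b J * h) (d + e))
      rw [map_add, map_add, eval_component_eq_zero hd ℓ.1 hw h2,
        weightedHomogeneousComponent_mul_right hh, zero_add, map_mul] at h3
      rw [h3]
      simp [Matrix.mulVec, dotProduct, M, smul_eval]
    refine finite_contactLocus_of_forall_eval ℓ.1 h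
      (fun J J' => ∑ J'', (M ℓ)⁻¹ J J'' * coeff (exps J') (b J'')) fun w hw J => ?_
    have h4 : (M ℓ)⁻¹.mulVec ((M ℓ).mulVec fun J' => eval w (mono J')) =
        fun J' => eval w (mono J') := by
      rw [Matrix.mulVec_mulVec, Matrix.nonsing_inv_mul _ (isUnit_iff_ne_zero.2 hℓ),
        Matrix.one_mulVec]
    rw [funext (key w hw)] at h4
    rw [← congrFun h4 J]
    simp only [Matrix.mulVec, dotProduct, weightedHomogeneousComponent_eq_sum, map_sum, smul_eval,
      Finset.sum_mul, Finset.mul_sum]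
    rw [Finset.sum_comm]
    exact Finset.sum_congr rfl fun _ _ => Finset.sum_congr rfl fun _ _ => by ring

end

/-! ### Zariski topology: density and openness in projective spaces -/

noncomputable section

section Topology

variable {V : Type*} [AddCommGroup V] [Module ℂ V]

/-- Irreducibility of `V`: on the line through `v₀` and `v₁` both restrictions are nonzero
polynomials in one variable over an infinite field. -/
theorem exists_eval_ne_zero_and {f g : MvPolynomial (Module.Dual ℂ V) ℂ} {v₀ v₁ : V}
    (hf : eval (fun φ => φ v₀) f ≠ 0) (hg : eval (fun φ => φ v₁) g ≠ 0) :
    ∃ v : V, eval (fun φ => φ v) f ≠ 0 ∧ eval (fun φ => φ v) g ≠ 0 := by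
  let γ : Module.Dual ℂ V → Polynomial ℂ := fun φ =>
    Polynomial.C (φ v₀) + Polynomial.X * Polynomial.C (φ (v₁ - v₀))
  have hγ : ∀ (t : ℂ) (p : MvPolynomial (Module.Dual ℂ V) ℂ),
      (aeval γ p).eval t = eval (fun φ => φ (v₀ + t • (v₁ - v₀))) p := by
    intro t p
    induction p using MvPolynomial.induction_on with
    | C a => simp
    | add p q hp hq => simp [hp, hq]
    | mul_X p φ hp => rw [map_mul, Polynomial.eval_mul, hp, map_mul, aeval_X, eval_X]; simp [γ]
  have hf' : aeval γ f ≠ 0 := fun h => hf (by simpa [h] using (hγ 0 f).symm)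
  have hg' : aeval γ g ≠ 0 := fun h => hg (by simpa [h] using (hγ 1 g).symm)
  obtain ⟨t, ht⟩ := Polynomial.exists_eval_ne_zero_of_natDegree_lt_card
    (aeval γ f * aeval γ g) (mul_ne_zero hf' hg') (by
      rw [Cardinal.mk_complex]
      exact Cardinal.natCast_lt_aleph0.trans Cardinal.aleph0_lt_continuum)
  rw [Polynomial.eval_mul, hγ, hγ] at ht
  exact ⟨_, left_ne_zero_of_mul ht, right_ne_zero_of_mul ht⟩

theorem isOpen_eval_ne_zero (f : MvPolynomial (Module.Dual ℂ V) ℂ) :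
    @IsOpen V (vecZariski V) {v | eval (fun φ => φ v) f ≠ 0} :=
  TopologicalSpace.isOpen_generateFrom_of_mem ⟨f, rfl⟩

theorem isOpen_eval_map_ne_zero (f : MvPolynomial (Module.Dual ℂ V) ℂ) (A : V →ₗ[ℂ] V) :
    @IsOpen V (vecZariski V) {v | eval (fun φ => φ (A v)) f ≠ 0} := by
  convert! isOpen_eval_ne_zero (rename (fun φ : Module.Dual ℂ V => φ ∘ₗ A) f) using 3
  simp [eval_rename, Function.comp_def]

/-- Since `f` need not be homogeneous, its nonvanishing set is saturated under scalars before
passing to the projective quotient. -/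
theorem isOpen_exists_smul (f : MvPolynomial (Module.Dual ℂ V) ℂ) :
    @IsOpen V (vecZariski V) {v | ∃ c : ℂ, c ≠ 0 ∧ eval (fun φ => φ (c • v)) f ≠ 0} := by
  have h : {v | ∃ c : ℂ, c ≠ 0 ∧ eval (fun φ => φ (c • v)) f ≠ 0} =
      ⋃ c : {c : ℂ // c ≠ 0}, {v | eval (fun φ => φ ((c.1 • LinearMap.id : V →ₗ[ℂ] V) v)) f ≠ 0} := by
    ext v
    simp only [Set.mem_iUnion, Set.mem_ofPred_eq, LinearMap.smul_apply, LinearMap.id_apply,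
      Subtype.exists, exists_prop]
  rw [h]
  exact @isOpen_iUnion _ _ (vecZariski V) _ fun c => isOpen_eval_map_ne_zero f _

theorem isOpen_exists_smul_pi {ι : Type*} {V : ι → Type*} [∀ i, AddCommGroup (V i)]
    [∀ i, Module ℂ (V i)] (f : MvPolynomial (Module.Dual ℂ (∀ i, V i)) ℂ) :
    @IsOpen (∀ i, V i) (vecZariski (∀ i, V i))
      {v | ∃ c : ι → ℂ, (∀ i, c i ≠ 0) ∧ eval (fun φ => φ fun i => c i • v i) f ≠ 0} := by
  have h : {v | ∃ c : ι → ℂ, (∀ i, c i ≠ 0) ∧ eval (fun φ => φ fun i => c i • v i) f ≠ 0} =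
      ⋃ c : {c : ι → ℂ // ∀ i, c i ≠ 0}, {v | eval (fun φ => φ ((LinearMap.pi fun i =>
        c.1 i • LinearMap.proj i : (∀ i, V i) →ₗ[ℂ] ∀ i, V i) v)) f ≠ 0} := by
    ext v
    simp only [Set.mem_iUnion, Set.mem_ofPred_eq, Subtype.exists, exists_prop]
    rfl
  rw [h]
  exact @isOpen_iUnion _ _ (vecZariski (∀ i, V i)) _ fun c => isOpen_eval_map_ne_zero f _

theorem mk_eq_mk_iff_ne_zero {v u : V} (hv : v ≠ 0) (hu : u ≠ 0) :
    Projectivization.mk ℂ u hu = Projectivization.mk ℂ v hv ↔ ∃ c : ℂ, c ≠ 0 ∧ u = c • v := by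
  rw [Projectivization.mk_eq_mk_iff']
  constructor
  · rintro ⟨a, rfl⟩
    exact ⟨a, fun h => hu (by rw [h, zero_smul]), rfl⟩
  · rintro ⟨a, _, rfl⟩
    exact ⟨a, rfl⟩

theorem exists_eval_ne_zero_subset {W : Set V} (hW : @IsOpen V (vecZariski V) W) {v : V}
    (hv : v ∈ W) : ∃ f : MvPolynomial (Module.Dual ℂ V) ℂ, eval (fun φ => φ v) f ≠ 0 ∧
      {v | eval (fun φ => φ v) f ≠ 0} ⊆ W := by
  induction hW with
  | basic s hs =>
    obtain ⟨f, rfl⟩ := hs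
    exact ⟨f, hv, subset_rfl⟩
  | univ => exact ⟨1, by simp, Set.subset_univ _⟩
  | inter s t _ _ hs ht =>
    obtain ⟨f, hf, hfs⟩ := hs hv.1
    obtain ⟨g, hg, hgt⟩ := ht hv.2
    refine ⟨f * g, by simpa using ⟨hf, hg⟩, fun u hu => ?_⟩
    simp only [map_mul, Set.mem_ofPred_eq] at hu
    exact ⟨hfs (left_ne_zero_of_mul hu), hgt (right_ne_zero_of_mul hu)⟩
  | sUnion S _ ih =>
    obtain ⟨t, ht, hvt⟩ := hv
    obtain ⟨f, hf, hft⟩ := ih t ht hvt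
    exact ⟨f, hf, hft.trans (Set.subset_sUnion_of_mem ht)⟩

theorem forGeneral_proj {P : Projectivization ℂ V → Prop} {D : MvPolynomial (Module.Dual ℂ V) ℂ}
    {v₀ : V} (hv₀ : v₀ ≠ 0) (hD : eval (fun φ => φ v₀) D ≠ 0)
    (hP : ∀ v (hv : v ≠ 0), eval (fun φ => φ v) D ≠ 0 → P (Projectivization.mk ℂ v hv)) :
    ForGeneral (projZariski V) P := by
  refine ⟨{x | ∃ v, ∃ hv : v ≠ 0, eval (fun φ => φ v) D ≠ 0 ∧ Projectivization.mk ℂ v hv = x},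
    ?_, ?_, ?_⟩
  · refine ⟨_, isOpen_exists_smul D, ?_⟩
    ext ⟨v, hv⟩
    simp only [Set.mem_preimage, Set.mem_ofPred_eq]
    constructor
    · rintro ⟨c, hc0, hc⟩
      exact ⟨c • v, smul_ne_zero hc0 hv, hc, (mk_eq_mk_iff_ne_zero _ _).2 ⟨c, hc0, rfl⟩⟩
    · rintro ⟨u, hu, hDu, h⟩
      obtain ⟨c, hc0, rfl⟩ := (mk_eq_mk_iff_ne_zero _ _).1 h
      exact ⟨c, hc0, hDu⟩
  · let _ := projZariski V
    refine dense_iff_inter_open.2 fun U hU ⟨x, hx⟩ => ?_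
    obtain ⟨W, hW, hWU⟩ := hU
    have hxW : x.rep ∈ W := by
      have : (⟨x.rep, x.rep_nonzero⟩ : {v : V // v ≠ 0}) ∈ Subtype.val ⁻¹' W := by
        rw [hWU, Set.mem_preimage, x.mk_rep]
        exact hx
      exact this
    obtain ⟨f, hf, hfW⟩ := exists_eval_ne_zero_subset hW hxW
    -- The extra factor `X φ` excludes the zero vector, where `D` might be nonzero.
    obtain ⟨φ, hφ⟩ : ∃ φ : Module.Dual ℂ V, φ v₀ ≠ 0 := by
      by_contra! h
      exact hv₀ ((Module.forall_dual_apply_eq_zero_iff ℂ v₀).1 h)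
    have hD' : eval (fun φ => φ v₀) (D * X φ) ≠ 0 := by
      rw [map_mul, eval_X]
      exact mul_ne_zero hD hφ
    obtain ⟨v, hfv, hDv⟩ := exists_eval_ne_zero_and hf hD'
    rw [map_mul, eval_X] at hDv
    have hv : v ≠ 0 := by
      rintro rfl
      simp at hDv
    refine ⟨Projectivization.mk ℂ v hv, ?_, v, hv, left_ne_zero_of_mul hDv, rfl⟩
    have : (⟨v, hv⟩ : {v : V // v ≠ 0}) ∈ Subtype.val ⁻¹' W := hfW hfv
    rw [hWU] at this
    exact this
  · rintro _ ⟨v, hv, hDv, rfl⟩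
    exact hP v hv hDv

theorem forGeneral_multiProj {ι : Type*} {V : ι → Type*} [∀ i, AddCommGroup (V i)]
    [∀ i, Module ℂ (V i)] {P : (∀ i, Projectivization ℂ (V i)) → Prop}
    {D : MvPolynomial (Module.Dual ℂ (∀ i, V i)) ℂ} {v₀ : ∀ i, V i}
    (hD : eval (fun φ => φ v₀) D ≠ 0)
    (hD0 : ∀ v : ∀ i, V i, eval (fun φ => φ v) D ≠ 0 → ∀ i, v i ≠ 0)
    (hP : ∀ (v : ∀ i, V i) (hv : ∀ i, v i ≠ 0), eval (fun φ => φ v) D ≠ 0 →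
      P fun i => Projectivization.mk ℂ (v i) (hv i)) :
    ForGeneral (multiProjZariski V) P := by
  refine ⟨{x | ∃ (v : ∀ i, V i) (hv : ∀ i, v i ≠ 0), eval (fun φ => φ v) D ≠ 0 ∧
    (fun i => Projectivization.mk ℂ (v i) (hv i)) = x}, ?_, ?_, ?_⟩
  · refine ⟨_, isOpen_exists_smul_pi D, ?_⟩
    ext ⟨v, hv⟩
    simp only [Set.mem_preimage, Set.mem_ofPred_eq]
    constructor
    · rintro ⟨c, hc0, hc⟩
      exact ⟨fun i => c i • v i, fun i => smul_ne_zero (hc0 i) (hv i), hc,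
        funext fun i => (mk_eq_mk_iff_ne_zero _ _).2 ⟨c i, hc0 i, rfl⟩⟩
    · rintro ⟨u, hu, hDu, h⟩
      choose c hc0 hc using fun i => (mk_eq_mk_iff_ne_zero _ _).1 (congrFun h i)
      obtain rfl : u = fun i => c i • v i := funext hc
      exact ⟨c, hc0, hDu⟩
  · let _ := multiProjZariski V
    refine dense_iff_inter_open.2 fun U hU ⟨x, hx⟩ => ?_
    obtain ⟨W, hW, hWU⟩ := hU
    have hxW : (fun i => (x i).rep) ∈ W := by
      have : (⟨fun i => (x i).rep, fun i => (x i).rep_nonzero⟩ : {v : ∀ i, V i // ∀ i, v i ≠ 0}) ∈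
          Subtype.val ⁻¹' W := by
        rw [hWU, Set.mem_preimage]
        simpa only [Projectivization.mk_rep] using hx
      exact this
    obtain ⟨f, hf, hfW⟩ := exists_eval_ne_zero_subset hW hxW
    obtain ⟨v, hfv, hDv⟩ := exists_eval_ne_zero_and hf hD
    refine ⟨fun i => Projectivization.mk ℂ (v i) (hD0 v hDv i), ?_, v, hD0 v hDv, hDv, rfl⟩
    have : (⟨v, hD0 v hDv⟩ : {v : ∀ i, V i // ∀ i, v i ≠ 0}) ∈ Subtype.val ⁻¹' W := hfW hfv
    rw [hWU] at this
    exact this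
  · rintro _ ⟨v, hv, hDv, rfl⟩
    exact hP v hv hDv

/-- The linear forms that vanish on a line have only that line as common zero locus. -/
theorem t1Space_projZariski : @T1Space (Projectivization ℂ V) (projZariski V) := by
  let _ := projZariski V
  refine ⟨fun x => ?_⟩
  rw [← isOpen_compl_iff]
  refine ⟨⋃ φ : {φ : Module.Dual ℂ V // φ x.rep = 0}, {v | φ.1 v ≠ 0},
    @isOpen_iUnion _ _ (vecZariski V) _ fun φ => by
      simpa using isOpen_eval_ne_zero (X φ.1 : MvPolynomial (Module.Dual ℂ V) ℂ), ?_⟩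
  ext ⟨v, hv⟩
  simp only [Set.mem_preimage, Set.mem_iUnion, Set.mem_compl_iff, Set.mem_singleton_iff,
    Set.mem_ofPred_eq]
  constructor
  · rintro ⟨φ, hφ⟩ h
    rw [← x.mk_rep, Projectivization.mk_eq_mk_iff'] at h
    obtain ⟨a, rfl⟩ := h
    exact hφ (by rw [map_smul, φ.2, smul_zero])
  · intro h
    have hv' : v ∉ Submodule.span ℂ {x.rep} := by
      intro hmem
      obtain ⟨a, ha⟩ := Submodule.mem_span_singleton.1 hmem
      exact h (by
        conv_rhs => rw [← x.mk_rep]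
        exact (Projectivization.mk_eq_mk_iff' ..).2 ⟨a, ha⟩)
    obtain ⟨φ, hφ, hker⟩ := Submodule.exists_le_ker_of_notMem hv'
    exact ⟨⟨φ, hker (Submodule.mem_span_singleton_self _)⟩, hφ⟩

theorem projDim_le_zero_of_finite {Z : Set (Projectivization ℂ V)} (hZ : Z.Finite) :
    projDim Z ≤ 0 := by
  let _ := projZariski V
  have := t1Space_projZariski (V := V)
  have := hZ.to_subtype
  exact topologicalKrullDim_zero_of_discreteTopology Z

end Topology

end

noncomputable section

variable {r : ℕ} {n d : Fin r → ℕ}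

/-! ### Linear changes of coordinates on the factors -/

/-- The action of linear maps of the factors on tuples of vectors. -/
def act (G : ∀ l, (Fin (n l + 1) → ℂ) →ₗ[ℂ] (Fin (n l + 1) → ℂ)) (w : Var n → ℂ) : Var n → ℂ :=
  fun s => G s.1 (fun i => w ⟨s.1, i⟩) s.2

/-- The linear forms that are the components of `act`. -/
def linForm (G : ∀ l, (Fin (n l + 1) → ℂ) →ₗ[ℂ] (Fin (n l + 1) → ℂ)) (s : Var n) :
    MvPolynomial (Var n) ℂ :=
  ∑ i, G s.1 (Pi.single i 1) s.2 • X (⟨s.1, i⟩ : Var n)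

/-- The substitution of linear forms for the variables. -/
def subst (G : ∀ l, (Fin (n l + 1) → ℂ) →ₗ[ℂ] (Fin (n l + 1) → ℂ)) :
    MvPolynomial (Var n) ℂ →ₐ[ℂ] MvPolynomial (Var n) ℂ := aeval (linForm G)

variable (G : ∀ l, (Fin (n l + 1) → ℂ) →ₗ[ℂ] (Fin (n l + 1) → ℂ))

theorem eval_linForm (w : Var n → ℂ) (s : Var n) : eval w (linForm G s) = act G w s := by
  rw [act, LinearMap.pi_apply_eq_sum_univ (G s.1), linForm, map_sum, Finset.sum_apply]
  refine Finset.sum_congr rfl fun i _ => ?_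
  rw [smul_eval, eval_X, Pi.smul_apply, smul_eq_mul, mul_comm]
  have e : (Pi.single i (1 : ℂ) : Fin (n s.1 + 1) → ℂ) = fun j => if i = j then 1 else 0 := by
    funext j
    simp [Pi.single_apply, eq_comm]
  rw [e]

theorem eval_subst (w : Var n → ℂ) (p : MvPolynomial (Var n) ℂ) :
    eval w (subst G p) = eval (act G w) p := by
  induction p using MvPolynomial.induction_on with
  | C a => simp [subst]
  | add p q hp hq => simp only [map_add, hp, hq]
  | mul_X p s hp => rw [map_mul, map_mul, hp, map_mul, eval_X, subst, aeval_X, eval_linForm]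

theorem pderiv_subst (t : Var n) (p : MvPolynomial (Var n) ℂ) :
    pderiv t (subst G p) = ∑ s, subst G (pderiv s p) * pderiv t (linForm G s) := by
  classical
  induction p using MvPolynomial.induction_on with
  | C a => simp [subst]
  | add p q hp hq => simp only [map_add, hp, hq, add_mul, Finset.sum_add_distrib]
  | mul_X p s hp =>
    have h1 : subst G (X s) = linForm G s := aeval_X _ _
    have h2 : ∀ u, subst G (pderiv u (p * X s)) =
        subst G p * subst G (pderiv u (X s)) + linForm G s * subst G (pderiv u p) := fun u => by
      rw [Derivation.leibniz, map_add, smul_eq_mul, smul_eq_mul, map_mul, map_mul, h1]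
    have h3 : ∑ u, subst G p * subst G (pderiv u (X s)) * pderiv t (linForm G u) =
        subst G p * pderiv t (linForm G s) := by
      rw [Finset.sum_eq_single s]
      · rw [pderiv_X_self, map_one, mul_one]
      · intro u _ hu
        rw [pderiv_X_of_ne hu.symm, map_zero, mul_zero, zero_mul]
      · exact fun hs => absurd (Finset.mem_univ s) hs
    rw [Finset.sum_congr rfl fun u _ => (congrArg (· * pderiv t (linForm G u)) (h2 u)).trans
      (add_mul _ _ _), Finset.sum_add_distrib, h3, map_mul, h1, Derivation.leibniz, hp, smul_eq_mul,
      smul_eq_mul, Finset.mul_sum]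
    exact congrArg _ (Finset.sum_congr rfl fun _ _ => (mul_assoc _ _ _).symm)

theorem isWeightedHomogeneous_linForm (s : Var n) :
    IsWeightedHomogeneous wt (linForm G s) (wt s) := by
  refine IsWeightedHomogeneous.sum _ _ _ fun i _ => ?_
  rw [smul_eq_C_mul]
  exact IsWeightedHomogeneous.C_mul (isWeightedHomogeneous_X ℂ wt (⟨s.1, i⟩ : Var n)) _

theorem subst_mono (J : Index n d) : subst G (mono J) = ∏ s, linForm G s ^ exps J s := by
  rw [mono_eq_monomial, subst, aeval_monomial, map_one, one_mul,
    Finsupp.prod_fintype _ _ (by simp)]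

theorem isWeightedHomogeneous_subst {p : MvPolynomial (Var n) ℂ}
    (hp : IsWeightedHomogeneous wt p d) : IsWeightedHomogeneous wt (subst G p) d := by
  rw [IsWeightedHomogeneous.eq_sum_mono hp, map_sum]
  refine IsWeightedHomogeneous.sum _ _ _ fun J _ => ?_
  rw [map_smul, subst_mono, smul_eq_C_mul]
  refine IsWeightedHomogeneous.C_mul ?_ _
  have h := IsWeightedHomogeneous.prod Finset.univ (fun s => linForm G s ^ exps J s)
    (fun s => exps J s • wt s) fun s _ => (isWeightedHomogeneous_linForm G s).pow _
  convert h using 1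
  funext l
  rw [← sum_exps J l, ← weight_wt, Finsupp.weight_apply, Finsupp.sum_fintype _ _ (by simp)]

/-! ### Vanishing orders -/

/-- By Leibniz, one derivative lowers the vanishing order by at most one. -/
theorem derivation_mem_pow {A : Type*} [CommRing A] [Algebra ℂ A] (D : Derivation ℂ A A)
    (I : Ideal A) (m : ℕ) {a : A} (ha : a ∈ I ^ (m + 1)) : D a ∈ I ^ m := by
  induction m generalizing a with
  | zero => simp
  | succ m ih =>
    rw [pow_succ] at ha
    refine Submodule.mul_induction_on ha (fun x hx y hy => ?_) fun x y hx hy => ?_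
    · rw [Derivation.leibniz, smul_eq_mul, smul_eq_mul]
      refine Ideal.add_mem _ (Ideal.mul_mem_right _ _ hx) ?_
      rw [pow_succ']
      exact Ideal.mul_mem_mul hy (ih hx)
    · rw [map_add]
      exact Ideal.add_mem _ hx hy

theorem foldr_pderiv_mem_pow {σ : Type*} (I : Ideal (MvPolynomial σ ℂ)) (L : List σ) (m : ℕ)
    {p : MvPolynomial σ ℂ} (hp : p ∈ I ^ (m + L.length)) :
    L.foldr (fun s f => pderiv s f) p ∈ I ^ m := by
  induction L generalizing m with
  | nil => exact hp
  | cons s L ih =>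
    rw [List.foldr_cons]
    refine derivation_mem_pow _ _ _ (ih (m + 1) ?_)
    rwa [List.length_cons, ← add_assoc, add_right_comm] at hp

/-- By induction all first partials are zero, and Euler's formula recovers a positive multiple of
`p` from them. -/
theorem eq_zero_of_foldr_pderiv {σ : Type*} [Fintype σ] (w : σ → ℂ) (m : ℕ)
    {p : MvPolynomial σ ℂ} (hp : p.IsHomogeneous m)
    (h : ∀ L : List σ, L.length ≤ m → eval w (L.foldr (fun s f => pderiv s f) p) = 0) : p = 0 := by
  induction m generalizing p with
  | zero =>
    rw [← totalDegree_zero_iff_isHomogeneous, totalDegree_eq_zero_iff_eq_C] at hp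
    have := h [] le_rfl
    rw [List.foldr_nil, hp, eval_C] at this
    rw [hp, this, C_0]
  | succ m ih =>
    have h1 : ∀ s, pderiv s p = 0 := fun s => ih hp.pderiv fun L hL => by
      have := h (L ++ [s]) (by simpa using hL)
      rwa [List.foldr_append] at this
    have h2 := hp.sum_X_mul_pderiv
    simp only [h1, mul_zero, Finset.sum_const_zero] at h2
    exact (smul_eq_zero.1 h2.symm).resolve_left (Nat.succ_ne_zero m)

theorem form_injective : Function.Injective (form : Module.Dual ℂ (Ambient n d) →ₗ[ℂ] _) := by
  classical
  rw [injective_iff_map_eq_zero]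
  intro ℓ h
  refine LinearMap.pi_ext' fun J => LinearMap.ext_ring ?_
  have := congrArg (coeff (exps J)) h
  rw [form_apply, coeff_sum, Finset.sum_eq_single J] at this
  · simpa [coeff_exps_mono] using this
  · intro J' _ hJ
    rw [coeff_smul, coeff_exps_mono, Matrix.one_apply_ne hJ, smul_zero]
  · simp

/-- With a single factor, one osculating space of order `d 0` already fills the ambient space. -/
theorem eq_zero_of_osculatingSpace_le [NeZero r] (hr : ∀ l : Fin r, l = 0)
    (ℓ : Module.Dual ℂ (Ambient n d)) (x : MultiProj n)
    (h : osculatingSpace d x (d 0) ≤ LinearMap.ker ℓ) : ℓ = 0 := by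
  rw [osculatingSpace_le_ker_iff] at h
  refine form_injective ((eq_zero_of_foldr_pderiv (fun s : Var n => (x s.1).rep s.2) (d 0) ?_
    h).trans (map_zero _).symm)
  rw [form_apply]
  refine IsHomogeneous.sum _ _ _ fun J _ => ?_
  rw [smul_eq_C_mul]
  refine IsHomogeneous.C_mul ?_ _
  rw [mono_eq_monomial]
  refine isHomogeneous_monomial _ ?_
  rw [Finsupp.degree_eq_sum, Fintype.sum_sigma, Fintype.sum_eq_single 0 (fun l hl => absurd (hr l) hl)]
  exact sum_exps J 0

theorem eval_eq_zero_of_pderiv {p : MvPolynomial (Var n) ℂ} (hp : IsWeightedHomogeneous wt p d)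
    {l : Fin r} (hd : 1 ≤ d l) {w : Var n → ℂ} (hw : ∀ s, eval w (pderiv s p) = 0) :
    eval w p = 0 := by
  have h : euler l p = (d l : ℂ) • p := by
    rw [IsWeightedHomogeneous.eq_sum_mono hp]
    simp only [map_sum, Derivation.map_smul, euler_mono, Finset.smul_sum]
    exact Finset.sum_congr rfl fun _ _ => smul_comm _ _ _
  rw [euler_eq_sum] at h
  have h2 := congrArg (eval w) h
  simp only [map_sum, map_mul, hw, mul_zero, Finset.sum_const_zero, smul_eval] at h2
  exact (mul_eq_zero.1 h2.symm).resolve_left (Nat.cast_ne_zero.2 (by omega))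

variable [NeZero r]

/-- The sum in `Adm` counts the variables of index other than k, with multiplicity; each pulls back
to a linear form vanishing at `w`. -/
theorem subst_mono_mem_pow (h : ∀ l, n 0 ≤ n l) {J : Index n d} (hJ : Adm h J)
    (k : Fin (n 0 + 1)) {w : Var n → ℂ} (hw : ∀ l j, j ≠ emb h l k → act G w ⟨l, j⟩ = 0) :
    subst G (mono J) ∈ RingHom.ker (eval w) ^ (d 0 + 1) := by
  classical
  refine Ideal.pow_le_pow_right (hJ.2 k) ?_
  have h1 : ∑ l, (d l - (J l : Multiset (Fin (n l + 1))).count (emb h l k)) =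
      ∑ s : Var n, if s.2 = emb h s.1 k then 0 else exps J s := by
    rw [Fintype.sum_sigma]
    refine Finset.sum_congr rfl fun l _ => ?_
    have h2 := sum_exps J l
    rw [← Finset.add_sum_erase _ _ (Finset.mem_univ (emb h l k)), exps_apply] at h2
    rw [← Finset.add_sum_erase _ _ (Finset.mem_univ (emb h l k)), if_pos rfl, zero_add,
      Finset.sum_congr rfl fun j hj => if_neg (Finset.ne_of_mem_erase hj)]
    exact Nat.sub_eq_of_eq_add' h2.symm
  rw [h1, subst_mono, ← Finset.prod_pow_eq_pow_sum]
  refine Ideal.prod_mem_prod fun s _ => ?_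
  split_ifs with hs
  · simp
  · refine Ideal.pow_mem_pow ?_ _
    rw [RingHom.mem_ker, eval_linForm]
    exact hw _ _ hs

theorem exists_linearEquiv_single (h : ∀ l, n 0 ≤ n l) (l : Fin r)
    (v : Fin (n 0 + 1) → Fin (n l + 1) → ℂ)
    (hv : (Matrix.of fun k j => v k (emb h l j)).det ≠ 0) :
    ∃ G : (Fin (n l + 1) → ℂ) ≃ₗ[ℂ] (Fin (n l + 1) → ℂ),
      ∀ k, G (Pi.single (emb h l k) 1) = v k := by
  classical
  -- The first `n 0 + 1` basis vectors go to the `v k` and the others stay fixed: a block triangular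
  -- map, invertible because of the minor in `hv`.
  let g : (Fin (n l + 1) → ℂ) →ₗ[ℂ] (Fin (n l + 1) → ℂ) :=
    ∑ k, (LinearMap.proj (R := ℂ) (φ := fun _ => ℂ) (emb h l k)).smulRight (v k) +
      LinearMap.pi fun i : Fin (n l + 1) => if (i : ℕ) ≤ n 0 then 0 else LinearMap.proj (R := ℂ) (φ := fun _ => ℂ) i
  have hg : ∀ x i, g x i = ∑ k, x (emb h l k) * v k i + if (i : ℕ) ≤ n 0 then 0 else x i := by
    intro x i
    simp only [g, LinearMap.add_apply, LinearMap.sum_apply, LinearMap.smulRight_apply,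
      LinearMap.proj_apply, Pi.add_apply, Finset.sum_apply, Pi.smul_apply, smul_eq_mul,
      LinearMap.pi_apply]
    split_ifs <;> rfl
  have hle : ∀ k : Fin (n 0 + 1), ((emb h l k : Fin (n l + 1)) : ℕ) ≤ n 0 := fun k => by
    simp only [emb, Fin.val_castLE]
    omega
  have hinj : Function.Injective g := by
    rw [injective_iff_map_eq_zero]
    intro x hx
    have h1 : (fun k => x (emb h l k)) = 0 := by
      refine Matrix.eq_zero_of_vecMul_eq_zero hv (funext fun j => ?_)
      have := congrFun hx (emb h l j)
      rw [hg, if_pos (hle j), add_zero] at this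
      exact this
    funext i
    by_cases hi : (i : ℕ) ≤ n 0
    · exact congrFun h1 ⟨i, by omega⟩
    · have := congrFun hx i
      rw [hg, if_neg hi, Finset.sum_eq_zero (fun k _ => by
        rw [congrFun h1 k, Pi.zero_apply, zero_mul]), zero_add] at this
      exact this
  refine ⟨LinearEquiv.ofInjectiveEndo g hinj, fun k => funext fun i => ?_⟩
  rw [LinearEquiv.coe_ofInjectiveEndo, hg, Finset.sum_eq_single k]
  · have : (if (i : ℕ) ≤ n 0 then 0 else (Pi.single (emb h l k) 1 : Fin (n l + 1) → ℂ) i) = 0 := by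
      split_ifs with hi
      · rfl
      · exact Pi.single_eq_of_ne (fun e => hi (by rw [e]; exact hle k)) _
    rw [this, Pi.single_eq_same, one_mul, add_zero]
  · intro k' _ hk'
    rw [Pi.single_eq_of_ne (fun e => hk' (emb_injective h l e)), zero_mul]
  · simp

end

/-! ### Moving general points to coordinate points, and conclusion -/

noncomputable section

variable {r : ℕ} {n d : Fin r → ℕ}

theorem act_act_symm (G : ∀ l, (Fin (n l + 1) → ℂ) ≃ₗ[ℂ] (Fin (n l + 1) → ℂ)) (w : Var n → ℂ) :
    act (fun l => (G l).toLinearMap) (act (fun l => (G l).symm.toLinearMap) w) = w := by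
  funext s
  exact congrFun ((G s.1).apply_symm_apply fun i => w ⟨s.1, i⟩) s.2

theorem act_symm_act (G : ∀ l, (Fin (n l + 1) → ℂ) ≃ₗ[ℂ] (Fin (n l + 1) → ℂ)) (w : Var n → ℂ) :
    act (fun l => (G l).symm.toLinearMap) (act (fun l => (G l).toLinearMap) w) = w :=
  act_act_symm (fun l => (G l).symm) w

theorem forGeneral_of_isEmpty {X : Type*} [IsEmpty X] (t : TopologicalSpace X) (P : X → Prop) :
    ForGeneral t P :=
  ⟨Set.univ, isOpen_univ, dense_univ, fun x => isEmptyElim x⟩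

theorem contactLocus_hyperplane_mk {T : Submodule ℂ (Ambient n d)} (ℓ : T.dualAnnihilator)
    (hℓ : ℓ ≠ 0) :
    hyperplane (Projectivization.mk ℂ ℓ hℓ) = LinearMap.ker (ℓ : Module.Dual ℂ (Ambient n d)) := by
  obtain ⟨a, ha⟩ := Projectivization.exists_smul_eq_mk_rep ℂ ℓ hℓ
  rw [hyperplane, ← ha]
  ext v
  simp [Units.smul_def]

variable [NeZero r]

/-- A form of the linear system of forms that vanish to order `d 0 + 1` at given points, together
with a form that does not vanish at its singular points. -/
theorem exists_form_of_linearEquiv (h : ∀ l, n 0 ≤ n l) (hn : 1 ≤ n 0) (hd : ∀ l, 1 ≤ d l)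
    (hgap : ∀ l, l ≠ 0 → d 0 + 2 ≤ d l) {l₁ : Fin r} (hl₁ : l₁ ≠ 0)
    (G : ∀ l, (Fin (n l + 1) → ℂ) ≃ₗ[ℂ] (Fin (n l + 1) → ℂ)) :
    ∃ (ℓ : Module.Dual ℂ (Ambient n d)) (H : MvPolynomial (Var n) ℂ),
      ℓ ≠ 0 ∧ IsWeightedHomogeneous wt H d ∧
      (∀ (x : MultiProj n) (k : Fin (n 0 + 1)),
        (∀ l, ∃ a : ℂ, (x l).rep = a • G l (Pi.single (emb h l k) 1)) →
          osculatingSpace d x (d 0) ≤ LinearMap.ker ℓ) ∧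
      ∀ w : Var n → ℂ, (∀ l, ∃ j, w ⟨l, j⟩ ≠ 0) →
        (∀ s, eval w (pderiv s (form ℓ)) = 0) → eval w H ≠ 0 := by
  classical
  let Gm := fun l => (G l).toLinearMap
  let Gi := fun l => (G l).symm.toLinearMap
  obtain ⟨c, hc, hδ⟩ := exists_algebraicIndependent_derivation {J : Index n d // Adm h J}
  let F : MvPolynomial (Var n) ℂ := ∑ J, c J • mono J.1
  have hF : IsWeightedHomogeneous wt F d := IsWeightedHomogeneous.sum _ _ _ fun J _ => by
    rw [smul_eq_C_mul]
    exact (isWeightedHomogeneous_mono J.1).C_mul _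
  have core : ∀ w : Var n → ℂ, (∀ l, ∃ j, w ⟨l, j⟩ ≠ 0) → (∀ s, eval w (pderiv s F) = 0) →
      ∃ k, ∀ l j, j ≠ emb h l k → w ⟨l, j⟩ = 0 := fun w hw hw' =>
    exists_support_of_singular h hd hgap hl₁ hc hδ hw (eval_eq_zero_of_pderiv hF (hd 0) hw') hw'
  -- At the k-th coordinate point exactly the k-th summand is nonzero.
  let H : MvPolynomial (Var n) ℂ :=
    ∑ k, mono (fun l => Sym.replicate (d l) (emb h l k) : Index n d)
  obtain ⟨ℓ, hℓ⟩ := exists_form_eq (isWeightedHomogeneous_subst Gi hF)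
  have hFG : subst Gm (form ℓ) = F := by
    refine MvPolynomial.funext fun w => ?_
    rw [hℓ, eval_subst, eval_subst, act_symm_act]
  refine ⟨ℓ, subst Gi H, ?_, ?_, ?_, ?_⟩
  · rintro rfl
    have hF0 : F = 0 := by rw [← hFG, map_zero, map_zero]
    -- A zero form would be singular at this point too, but its indices 0 and `n 0` differ, so it is
    -- none of the (e_k, …, e_k).
    let σ : ∀ l, Fin (n l + 1) := fun l => emb h l (if l = 0 then 0 else Fin.last _)
    obtain ⟨k, hk⟩ := core (fun s => if s.2 = σ s.1 then 1 else 0) (fun l => ⟨σ l, by simp⟩)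
      (fun s => by simp [hF0])
    have hσ : ∀ l, σ l = emb h l k := fun l => by
      by_contra hne
      simpa using hk l (σ l) hne
    have e0 := emb_injective h 0 (hσ 0)
    have e1 := emb_injective h l₁ (hσ l₁)
    rw [if_pos rfl] at e0
    rw [if_neg hl₁, ← e0] at e1
    have := congrArg Fin.val e1
    simp at this
    omega
  · exact isWeightedHomogeneous_subst Gi
      (IsWeightedHomogeneous.sum _ _ _ fun k _ => isWeightedHomogeneous_mono _)
  · intro x k hx
    rw [osculatingSpace_le_ker_iff]
    intro L hL
    rw [evalAt_eq_eval]
    set w : Var n → ℂ := fun s => (x s.1).rep s.2 with hw_def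
    have hw : ∀ l j, j ≠ emb h l k → act Gi w ⟨l, j⟩ = 0 := by
      intro l j hj
      obtain ⟨a, ha⟩ := hx l
      have : act Gi w ⟨l, j⟩ = (G l).symm ((x l).rep) j := rfl
      rw [this, ha, map_smul, LinearEquiv.symm_apply_apply, Pi.smul_apply,
        Pi.single_eq_of_ne hj, smul_zero]
    have hmem : form ℓ ∈ RingHom.ker (eval w) ^ (d 0 + 1) := by
      rw [hℓ, map_sum]
      refine Ideal.sum_mem _ fun J _ => ?_
      rw [map_smul, smul_eq_C_mul]
      exact Ideal.mul_mem_left _ _ (subst_mono_mem_pow Gi h J.2 k hw)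
    -- At most `d 0` derivatives leave order at least 1 out of `d 0 + 1`.
    have := foldr_pderiv_mem_pow (RingHom.ker (eval w)) L 1
      (Ideal.pow_le_pow_right (by omega) hmem)
    rwa [pow_one, RingHom.mem_ker] at this
  · intro w hw hw'
    have hw0 : ∀ l, ∃ j, act Gi w ⟨l, j⟩ ≠ 0 := by
      intro l
      by_contra! hcon
      obtain ⟨j, hj⟩ := hw l
      have h0 : (G l).symm (fun i => w ⟨l, i⟩) = 0 := funext hcon
      rw [LinearEquiv.map_eq_zero_iff] at h0
      exact hj (congrFun h0 j)
    obtain ⟨k, hk⟩ := core (act Gi w) hw0 fun t => by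
      rw [← hFG, pderiv_subst, map_sum]
      refine Finset.sum_eq_zero fun s _ => ?_
      rw [map_mul, eval_subst, act_act_symm, hw', zero_mul]
    rw [eval_subst, map_sum, Finset.sum_eq_single k]
    · refine eval_mono_ne_zero fun l j hj => ?_
      rw [Sym.coe_replicate] at hj
      obtain ⟨i, hi⟩ := hw0 l
      rw [Multiset.eq_of_mem_replicate hj]
      by_cases e : i = emb h l k
      · exact e ▸ hi
      · exact absurd (hk l i e) hi
    · intro k' _ hk'
      rw [eval_mono]
      refine Finset.prod_eq_zero (Finset.mem_univ (⟨0, emb h 0 k'⟩ : Var n)) ?_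
      rw [hk 0 _ fun e => hk' (emb_injective h 0 e), exps_apply, Sym.coe_replicate,
        Multiset.count_replicate_self, zero_pow]
      exact Nat.ne_of_gt (hd 0)
    · simp

/-- Existence of hyperplanes through the osculating spaces, and finiteness of the contact loci. -/
theorem forGeneral_osculating_contactLocus (n d : Fin r → ℕ)
    (hn : ∀ l, 1 ≤ n l) (hmono : Monotone n) (hd : ∀ l, 1 ≤ d l)
    (hgap : ∀ l, l ≠ 0 → d 0 + 2 ≤ d l) :
    ForGeneral
      (multiProjZariski
        fun i : Fin (n 0 + 1) × Fin r => (Fin (n i.2 + 1) → ℂ))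
      fun p =>
        let T : Submodule ℂ (Ambient n d) :=
          ⨆ k : Fin (n 0 + 1), osculatingSpace d (fun l => p (k, l)) (d 0)
        (2 ≤ r → T ≠ ⊤) ∧
        ForGeneral (projZariski T.dualAnnihilator)
          fun ℓ => ¬ ∃ Z : Set (Projectivization ℂ (Ambient n d)),
            IsSubvariety Z ∧ 0 < projDim Z ∧
            Z ⊆ contactLocus (hyperplane ℓ) := by
  classical
  have h : ∀ l, n 0 ≤ n l := fun l => hmono (Fin.zero_le l)
  let V : Fin (n 0 + 1) × Fin r → Type := fun i => Fin (n i.2 + 1) → ℂ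
  let coord : ∀ (l : Fin r) (k j : Fin (n 0 + 1)), Module.Dual ℂ (∀ i, V i) := fun l k j =>
    (LinearMap.proj (R := ℂ) (φ := fun _ : Fin (n l + 1) => ℂ) (emb h l j)) ∘ₗ
      (LinearMap.proj (R := ℂ) (φ := V) (k, l))
  -- In each factor, the leading maximal minor of the matrix of the `n 0 + 1` vectors: its
  -- nonvanishing permits the change of coordinates.
  let D : MvPolynomial (Module.Dual ℂ (∀ i, V i)) ℂ :=
    ∏ l, (Matrix.of fun k j => X (coord l k j) : Matrix _ _ _).det
  have hD : ∀ v : ∀ i, V i, eval (fun φ => φ v) D =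
      ∏ l, (Matrix.of fun k j => v (k, l) (emb h l j) : Matrix _ _ ℂ).det := by
    intro v
    simp only [D, map_prod]
    refine Finset.prod_congr rfl fun l _ => ?_
    rw [RingHom.map_det]
    congr 1
    ext k j
    simp [coord]
  refine forGeneral_multiProj (D := D) (v₀ := fun i => Pi.single (emb h i.2 i.1) 1) ?_ ?_ ?_
  · rw [hD, Finset.prod_ne_zero_iff]
    intro l _
    have : (Matrix.of fun k j => (Pi.single (emb h l k) 1 : Fin (n l + 1) → ℂ) (emb h l j) :
        Matrix _ _ ℂ) = 1 := by
      ext k j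
      simp [Matrix.one_apply, Pi.single_apply, (emb_injective h l).eq_iff, eq_comm]
    rw [this, Matrix.det_one]
    exact one_ne_zero
  · rintro v hv ⟨k, l⟩ h0
    rw [hD, Finset.prod_ne_zero_iff] at hv
    exact hv l (Finset.mem_univ l) (Matrix.det_eq_zero_of_row_eq_zero k fun j => by
      rw [Matrix.of_apply, h0]; rfl)
  intro v hv0 hv
  rw [hD, Finset.prod_ne_zero_iff] at hv
  intro T
  have hT : ∀ ℓ : Module.Dual ℂ (Ambient n d), T ≤ LinearMap.ker ℓ → ℓ ∈ T.dualAnnihilator :=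
    fun ℓ hℓ => (Submodule.mem_dualAnnihilator ℓ).2 fun w hw => hℓ hw
  by_cases hr : ∀ l : Fin r, l = 0
  · refine ⟨fun h2 => absurd (hr ⟨1, h2⟩) (by simp [Fin.ext_iff]), ?_⟩
    have : IsEmpty (Projectivization ℂ T.dualAnnihilator) := by
      refine ⟨fun x => x.rep_nonzero (Subtype.ext ?_)⟩
      refine eq_zero_of_osculatingSpace_le hr _
        (fun l => Projectivization.mk ℂ (v (0, l)) (hv0 (0, l))) ?_
      refine le_trans (le_iSup (fun k : Fin (n 0 + 1) => osculatingSpace d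
        (fun l => Projectivization.mk ℂ (v (k, l)) (hv0 (k, l))) (d 0)) 0) fun w hw => ?_
      exact (Submodule.mem_dualAnnihilator _).1 x.rep.2 w hw
    exact forGeneral_of_isEmpty _ _
  push Not at hr
  obtain ⟨l₁, hl₁⟩ := hr
  choose G hG using fun l => exists_linearEquiv_single h l (fun k => v (k, l))
    (hv l (Finset.mem_univ l))
  obtain ⟨ℓ, H, hℓ0, hH, hosc, hne⟩ := exists_form_of_linearEquiv h (hn 0) hd hgap hl₁ G
  have hℓT : ℓ ∈ T.dualAnnihilator := hT ℓ (iSup_le fun k => hosc _ k fun l => by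
    obtain ⟨a, ha⟩ := Projectivization.exists_smul_eq_mk_rep ℂ (v (k, l)) (hv0 (k, l))
    exact ⟨a, by rw [hG, ← ha, Units.smul_def]⟩)
  refine ⟨fun _ hT' => hℓ0 ?_, ?_⟩
  · rw [hT', Submodule.dualAnnihilator_top] at hℓT
    exact hℓT
  obtain ⟨E, hE, hfin⟩ := exists_open_finite_contactLocus hd T.dualAnnihilator ⟨ℓ, hℓT⟩ hH hne
  refine forGeneral_proj (D := E) (v₀ := ⟨ℓ, hℓT⟩) (fun e => hℓ0 (congrArg Subtype.val e)) hE ?_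
  rintro m hm0 hm ⟨Z, -, hZ, hZc⟩
  rw [contactLocus_hyperplane_mk] at hZc
  exact absurd hZ (not_lt.2 (projDim_le_zero_of_finite ((hfin m hm).subset hZc)))

end

end SegreVeronese

theorem mainTheorem9 {r : ℕ} [NeZero r] (n d : Fin r → ℕ)
    (hn : ∀ l, 1 ≤ n l) (hmono : Monotone n) (hd : ∀ l, 1 ≤ d l)
    (hgap : ∀ l, l ≠ 0 → d 0 + 2 ≤ d l) :
    SegreVeronese.ForGeneral
      (SegreVeronese.multiProjZariski
        fun i : Fin (n 0 + 1) × Fin r => (Fin (n i.2 + 1) → ℂ))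
      fun p =>
        let T : Submodule ℂ (SegreVeronese.Ambient n d) :=
          ⨆ k : Fin (n 0 + 1), SegreVeronese.osculatingSpace d (fun l => p (k, l)) (d 0)
        (2 ≤ r → T ≠ ⊤) ∧
        SegreVeronese.ForGeneral (SegreVeronese.projZariski T.dualAnnihilator)
          fun ℓ => ¬ ∃ Z : Set (Projectivization ℂ (SegreVeronese.Ambient n d)),
            SegreVeronese.IsSubvariety Z ∧ 0 < SegreVeronese.projDim Z ∧
            Z ⊆ SegreVeronese.contactLocus (SegreVeronese.hyperplane ℓ) :=
  SegreVeronese.forGeneral_osculating_contactLocus n d hn hmono hd hgap
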